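/- Let $K$ be a field, $\theta : K \to K$ a ring homomorphism and $\delta : K \to K$ a $\theta$-derivation (an additive map with $\delta(ab)=\theta(a)\delta(b)+\delta(a)b$), with $(\theta,\delta)\neq(\mathrm{id}_K,0)$. Let $F=\{a\in K : \theta(a)=a,\ \delta(a)=0\}$ and assume that $K/F$ is finite. **Notation.** Let $\mathcal A^+=K[X;\theta,\delta]$ be the ring of Ore polynomials ($Xa=\theta(a)X+\delta(a)$ for $a \in K$), $\mathcal A^+_{<k}$ the set of those of degree $<k$, and $\mathcal A$ the skew field of fractions of $\mathcal A^+$. For $c\in K$, let $\mathrm{ev}_c:\mathcal A^+\to \mathrm{End}_F(K)$ be the ring homomorphism $P\mapsto P(\delta+c\theta)$; call $c$ *unramified* if $\delta+c\theta$ is not a scalar multiple of $\mathrm{id}_K$. If $\theta\ne\mathrm{id}_K$, let $a\in K$ be the element with $\delta=a(\theta-\mathrm{id}_K)$. Let $Z(X)\in\mathcal A^+$ be the monic polynomial of minimal degree with $Z(\delta)=0$ if $\theta=\mathrm{id}_K$, and $Z(X)=(X+a)^s$, with $s$ the order of $\theta$, otherwise. The centre of $\mathcal A^+$ is $F[Z(X)]$.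 For $c\in K$ let $\upsilon(c) \in F$ be the remainder in the right Euclidean division of $Z(X)$ by $X-c$. Let $c$ be unramified, $z=\upsilon(c)$ and $N=Z(X)-z$. A *$z$-admissible isomorphism* is an isomorphism of $K$-algebras $\varprojlim_{r>0}\mathcal A^+/N^r\mathcal A^+\to(\mathcal A^+/N\mathcal A^+)[[T]]$ that maps $N$ to $T$ and induces the identity modulo $N$ on the left and modulo $T$ on the right. A *Taylor expansion at $z$* is a ring homomorphism $\mathrm{TS}_z:\mathcal A\to(\mathcal A^+/N\mathcal A^+)((T))$ that extends the map on $\mathcal A^+$ given by a $z$-admissible isomorphism. The *skew residue* $\mathrm{sres}_z(f)\in\mathcal A^+/N\mathcal A^+$ of $f\in\mathcal A$ is the coefficient of $T^{-1}$ in $\mathrm{TS}_z(f)$. The map $\mathrm{ev}_c$ factors through $\mathcal A^+/N\mathcal A^+$. **The code.** Let $\underline c=(c_1,\dots,c_m)$ be unramified elements of $K$ such that the $z_i=\upsilon(c_i)$ are pairwise distinct, let $\underline V=(V_1,\dots,V_m)$ be $F$-linear subspaces of $K$, put $n=\sum_{i=1}^m\dim_F K/V_i$, and let $k$ be an integer with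 $0<k<n$. Let $D\in\mathcal A^+$ be the monic polynomial of degree $n$ such that $\mathrm{im}\,\mathrm{ev}_{c_i}(D)=V_i$ for all $i$. Let $P=D^{-1}\in \mathcal A$ if $\theta=\mathrm{id}_K$, and $P=Z(X)^{-m-1}(X+a)^{n-k}D^{-1}$ otherwise. The *linearized Goppa code* $\mathrm{LG}(k,\underline c,\underline V)$ is the $K$-linear subspace $$\bigl\{\bigl(\mathrm{ev}_{c_1}(\mathrm{sres}_{z_1}(gP)),\dots,\mathrm{ev}_{c_m}(\mathrm{sres}_{z_m}(gP))\bigr)\ :\ g\in\mathcal A^+_{<k}\bigr\}$$ of $\prod_{i=1}^m\mathrm{Hom}_F(K/V_i,K)$, where $\mathrm{Hom}_F(K/V_i,K)$ is identified with the space of $F$-linear endomorphisms of $K$ that vanish on $V_i$. The *length* of a $K$-linear subspace of $\prod_i\mathrm{Hom}_F(K/V_i,K)$ is $\sum_i\dim_F K/V_i$, its *dimension* is its dimension over $K$, and its *minimum sum-rank distance* is the least value of $\sum_i\dim_F\mathrm{im}\,\varphi_i$ over its nonzero elements $(\varphi_1,\dots,\varphi_m)$; it is *MSRD* if dimension $+$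 distance $=$ length $+\,1$ (equality in the Singleton bound). **Statement.** Taylor expansions at each $z_i$ exist and, for any choice of them, the code $\mathrm{LG}(k,\underline c,\underline V)$ has length $n$, dimension $k$ and minimum sum-rank distance $n-k+1$. In particular it is MSRD. -/

import Mathlib

open Polynomial

noncomputable section

namespace OreCode

/-! ### Skew derivations, Ore polynomials -/

/-- A `θ`-derivation of `K`: an additive map with `δ (a b) = θ a δ b + δ a b`. -/
structure SkewDerivation {K : Type*} [Field K] (θ : K →+* K) extends K →+ K where
  leibniz' : ∀ a b : K, toFun (a * b) = θ a * toFun b + toFun a * b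

section Basic

variable {K : Type*} [Field K] {θ : K →+* K}

instance : CoeFun (SkewDerivation θ) (fun _ => K → K) := ⟨fun δ => δ.toFun⟩

theorem SkewDerivation.leibniz (δ : SkewDerivation θ) (a b : K) :
    δ (a * b) = θ a * δ b + δ a * b := δ.leibniz' a b

theorem SkewDerivation.map_add (δ : SkewDerivation θ) (a b : K) : δ (a + b) = δ a + δ b :=
  δ.map_add' a b

theorem SkewDerivation.map_zero (δ : SkewDerivation θ) : δ 0 = 0 := δ.map_zero'

theorem SkewDerivation.map_one (δ : SkewDerivation θ) : δ 1 = 0 := by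
  have h := δ.leibniz 1 1
  simpa using h

theorem SkewDerivation.map_neg (δ : SkewDerivation θ) (a : K) : δ (-a) = -δ a :=
  _root_.map_neg δ.toAddMonoidHom a

/-- The subfield `F` of the `a` in `K` with `θ a = a` and `δ a = 0`. -/
def constField (δ : SkewDerivation θ) : Subfield K where
  carrier := {a | θ a = a ∧ δ a = 0}
  mul_mem' := by
    rintro a b ⟨ha, ha'⟩ ⟨hb, hb'⟩
    exact ⟨by rw [_root_.map_mul, ha, hb], by rw [δ.leibniz, ha', hb']; ring⟩
  one_mem' := ⟨_root_.map_one θ, δ.map_one⟩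
  add_mem' := by
    rintro a b ⟨ha, ha'⟩ ⟨hb, hb'⟩
    exact ⟨by rw [_root_.map_add, ha, hb], by rw [δ.map_add, ha', hb', add_zero]⟩
  zero_mem' := ⟨_root_.map_zero θ, δ.map_zero⟩
  neg_mem' := by
    rintro a ⟨ha, ha'⟩
    exact ⟨by rw [_root_.map_neg, ha], by rw [δ.map_neg, ha', neg_zero]⟩
  inv_mem' := by
    rintro a ⟨ha, ha'⟩
    refine ⟨by rw [map_inv₀, ha], ?_⟩
    by_cases h0 : a = 0
    · rw [h0, inv_zero]; exact δ.map_zero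
    · have h := δ.leibniz a a⁻¹
      rw [mul_inv_cancel₀ h0, δ.map_one, ha, ha', zero_mul, add_zero] at h
      exact (mul_eq_zero.mp h.symm).resolve_left h0

/-- The underlying additive group of `K[X; θ, δ]`: polynomials with coefficients on the left. -/
def OrePoly (_δ : SkewDerivation θ) : Type _ := K[X]

variable (δ : SkewDerivation θ)

instance : AddCommGroup (OrePoly δ) := inferInstanceAs (AddCommGroup K[X])
instance : Module K (OrePoly δ) := inferInstanceAs (Module K K[X])

/-- The underlying commutative polynomial (same coefficients). -/
def OrePoly.toPoly : OrePoly δ ≃ₗ[K] K[X] := LinearEquiv.refl K K[X]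

/-- The monomial `a X ^ i`. -/
def OrePoly.mono (i : ℕ) : K →ₗ[K] OrePoly δ :=
  (OrePoly.toPoly δ).symm.toLinearMap ∘ₗ Polynomial.monomial i

variable {δ} in
theorem OrePoly.induction {p : OrePoly δ → Prop} (P : OrePoly δ)
    (hadd : ∀ P Q, p P → p Q → p (P + Q)) (hm : ∀ i a, p (OrePoly.mono δ i a)) : p P :=
  Polynomial.induction_on' (motive := fun q => p ((OrePoly.toPoly δ).symm q)) P
    (fun P Q hP hQ => hadd P Q hP hQ) (fun i a => hm i a)

/-- The additive extension of a family of additive maps on monomials. -/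
def OrePoly.sumHom {M : Type*} [AddCommGroup M] (f : ℕ → K →+ M) : OrePoly δ →+ M where
  toFun P := (OrePoly.toPoly δ P).sum fun i a => f i a
  map_zero' := by simp
  map_add' P Q := by
    rw [_root_.map_add]
    exact Polynomial.sum_add_index _ _ _ (fun i => _root_.map_zero _) (fun i => _root_.map_add _)

@[simp] theorem OrePoly.sumHom_mono {M : Type*} [AddCommGroup M] (f : ℕ → K →+ M) (i : ℕ) (a : K) :
    OrePoly.sumHom δ f (OrePoly.mono δ i a) = f i a := by
  change (Polynomial.monomial i a).sum (fun i a => f i a) = _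
  exact Polynomial.sum_monomial_index _ _ (_root_.map_zero _)

theorem OrePoly.smul_mono (a b : K) (i : ℕ) :
    a • OrePoly.mono δ i b = OrePoly.mono δ i (a * b) := by
  rw [← smul_eq_mul, _root_.map_smul]

/-- Left multiplication by `X`, as dictated by the rule `X b = θ b X + δ b`:
it sends `b X ^ i` to `θ b X ^ (i + 1) + δ b X ^ i`. -/
def OrePoly.mulX : OrePoly δ →+ OrePoly δ :=
  OrePoly.sumHom δ fun i =>
    ((OrePoly.mono δ (i + 1)).toAddMonoidHom.comp θ.toAddMonoidHom) +
      ((OrePoly.mono δ i).toAddMonoidHom.comp δ.toAddMonoidHom)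

@[simp] theorem OrePoly.mulX_mono (i : ℕ) (b : K) :
    OrePoly.mulX δ (OrePoly.mono δ i b) =
      OrePoly.mono δ (i + 1) (θ b) + OrePoly.mono δ i (δ b) := by
  rw [OrePoly.mulX, OrePoly.sumHom_mono]; rfl

theorem OrePoly.mulX_smul (a : K) (P : OrePoly δ) :
    OrePoly.mulX δ (a • P) = θ a • OrePoly.mulX δ P + δ a • P := by
  induction P using OrePoly.induction with
  | hadd P Q hP hQ => simp only [smul_add, _root_.map_add, hP, hQ]; abel
  | hm i b =>
    rw [OrePoly.smul_mono, OrePoly.mulX_mono, OrePoly.mulX_mono, smul_add, OrePoly.smul_mono,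
      OrePoly.smul_mono, OrePoly.smul_mono, _root_.map_mul, δ.leibniz, _root_.map_add, add_assoc]

/-- Multiplication of Ore polynomials: `(∑ aᵢ X ^ i) Q = ∑ aᵢ (X (X (⋯ Q)))`. -/
def OrePoly.mulHom (Q : OrePoly δ) : OrePoly δ →+ OrePoly δ :=
  OrePoly.sumHom δ fun i =>
    (LinearMap.toSpanSingleton K (OrePoly δ) ((OrePoly.mulX δ)^[i] Q)).toAddMonoidHom

instance : Mul (OrePoly δ) := ⟨fun P Q => OrePoly.mulHom δ Q P⟩
instance : One (OrePoly δ) := ⟨OrePoly.mono δ 0 1⟩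

theorem OrePoly.mono_mul (i : ℕ) (a : K) (Q : OrePoly δ) :
    OrePoly.mono δ i a * Q = a • (OrePoly.mulX δ)^[i] Q :=
  OrePoly.sumHom_mono δ _ i a

theorem OrePoly.add_mul' (P P' Q : OrePoly δ) : (P + P') * Q = P * Q + P' * Q :=
  _root_.map_add (OrePoly.mulHom δ Q) P P'

theorem OrePoly.mul_add' (P Q Q' : OrePoly δ) : P * (Q + Q') = P * Q + P * Q' := by
  induction P using OrePoly.induction with
  | hadd P P' h h' => simp only [OrePoly.add_mul', h, h']; abel
  | hm i a => simp only [OrePoly.mono_mul, iterate_map_add, smul_add]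

theorem OrePoly.smul_mul' (a : K) (P Q : OrePoly δ) : (a • P) * Q = a • (P * Q) := by
  induction P using OrePoly.induction with
  | hadd P P' h h' => simp only [smul_add, OrePoly.add_mul', h, h']
  | hm i b => rw [OrePoly.smul_mono, OrePoly.mono_mul, OrePoly.mono_mul, mul_smul]

theorem OrePoly.mulX_mul (P Q : OrePoly δ) :
    (OrePoly.mulX δ P) * Q = OrePoly.mulX δ (P * Q) := by
  induction P using OrePoly.induction with
  | hadd P P' h h' => simp only [_root_.map_add, OrePoly.add_mul', h, h']
  | hm i b =>
    rw [OrePoly.mulX_mono, OrePoly.add_mul', OrePoly.mono_mul, OrePoly.mono_mul, OrePoly.mono_mul,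
      OrePoly.mulX_smul, Function.iterate_succ_apply']

theorem OrePoly.mul_assoc' (P Q R : OrePoly δ) : P * Q * R = P * (Q * R) := by
  induction P using OrePoly.induction with
  | hadd P P' h h' => simp only [OrePoly.add_mul', h, h']
  | hm i a =>
    rw [OrePoly.mono_mul, OrePoly.mono_mul, OrePoly.smul_mul']
    congr 1
    induction i with
    | zero => rfl
    | succ i ih => rw [Function.iterate_succ_apply', Function.iterate_succ_apply',
        OrePoly.mulX_mul, ih]

theorem OrePoly.mulX_iterate_one (i : ℕ) :
    (OrePoly.mulX δ)^[i] (OrePoly.mono δ 0 1) = OrePoly.mono δ i 1 := by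
  induction i with
  | zero => rfl
  | succ i ih =>
    rw [Function.iterate_succ_apply', ih, OrePoly.mulX_mono, _root_.map_one, δ.map_one,
      _root_.map_zero, add_zero]

/-- The ring `K[X; θ, δ]`. -/
instance : Ring (OrePoly δ) where
  mul := (· * ·)
  one := 1
  left_distrib := OrePoly.mul_add' δ
  right_distrib := OrePoly.add_mul' δ
  mul_assoc := OrePoly.mul_assoc' δ
  zero_mul Q := _root_.map_zero (OrePoly.mulHom δ Q)
  mul_zero P := by
    have h := OrePoly.mul_add' δ P 0 0
    rw [add_zero] at h
    exact left_eq_add.mp h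
  one_mul Q := by
    change OrePoly.mono δ 0 1 * Q = Q
    rw [OrePoly.mono_mul, one_smul]; rfl
  mul_one P := by
    change P * OrePoly.mono δ 0 1 = P
    induction P using OrePoly.induction with
    | hadd P P' h h' => rw [OrePoly.add_mul', h, h']
    | hm i a => rw [OrePoly.mono_mul, OrePoly.mulX_iterate_one, OrePoly.smul_mono, mul_one]
  neg_add_cancel := neg_add_cancel
  zsmul := (· • ·)
  zsmul_zero' := SubNegMonoid.zsmul_zero'
  zsmul_succ' := SubNegMonoid.zsmul_succ'
  zsmul_neg' := SubNegMonoid.zsmul_neg'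
  nsmul := (· • ·)
  nsmul_zero := AddMonoid.nsmul_zero
  nsmul_succ := AddMonoid.nsmul_succ
  sub_eq_add_neg := sub_eq_add_neg

/-- The variable `X`. -/
def OrePoly.X : OrePoly δ := OrePoly.mono δ 1 1

/-- Constants, as a ring homomorphism `K → K[X; θ, δ]`. -/
def OrePoly.C : K →+* OrePoly δ where
  toFun := OrePoly.mono δ 0
  map_one' := rfl
  map_zero' := _root_.map_zero _
  map_add' := _root_.map_add _
  map_mul' a b := by
    rw [OrePoly.mono_mul, Function.iterate_zero, id, OrePoly.smul_mono]

theorem OrePoly.C_mul (a : K) (P : OrePoly δ) : OrePoly.C δ a * P = a • P :=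
  OrePoly.mono_mul δ 0 a P

theorem OrePoly.X_mul (P : OrePoly δ) : OrePoly.X δ * P = OrePoly.mulX δ P := by
  rw [OrePoly.X, OrePoly.mono_mul, one_smul]; rfl

/-- The defining commutation rule. -/
theorem OrePoly.X_mul_C (a : K) :
    OrePoly.X δ * OrePoly.C δ a = OrePoly.C δ (θ a) * OrePoly.X δ + OrePoly.C δ (δ a) := by
  rw [OrePoly.X_mul, OrePoly.C_mul, OrePoly.X, OrePoly.smul_mono, mul_one]
  exact OrePoly.mulX_mono δ 0 a

theorem OrePoly.mono_eq (i : ℕ) (a : K) :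
    OrePoly.mono δ i a = OrePoly.C δ a * OrePoly.X δ ^ i := by
  have h : OrePoly.X δ ^ i = OrePoly.mono δ i 1 := by
    induction i with
    | zero => rfl
    | succ i ih =>
      rw [pow_succ', ih, OrePoly.X_mul, OrePoly.mulX_mono, _root_.map_one, δ.map_one,
        _root_.map_zero, add_zero]
  rw [h, OrePoly.C_mul, OrePoly.smul_mono, mul_one]

/-! ### Evaluation -/

/-- The pseudo-linear endomorphism `δ + c θ` of `K`. -/
def pseudoLinear (c : K) : Module.End (constField δ) K where
  toFun x := δ x + c * θ x
  map_add' x y := by rw [δ.map_add, _root_.map_add]; ring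
  map_smul' a x := by
    have h1 : θ (a : K) = a := a.2.1
    have h2 : δ (a : K) = 0 := a.2.2
    simp only [Subfield.smul_def, smul_eq_mul, δ.leibniz, _root_.map_mul, h1, h2, RingHom.id_apply]
    ring

theorem pseudoLinear_smul (c a x : K) :
    pseudoLinear δ c (a * x) = θ a * pseudoLinear δ c x + δ a * x := by
  change δ (a * x) + c * θ (a * x) = θ a * (δ x + c * θ x) + δ a * x
  rw [δ.leibniz, _root_.map_mul]; ring

/-- The additive map underlying `evalAt`: `∑ aᵢ X ^ i ↦ ∑ aᵢ (δ + c θ) ^ i`. -/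
def evalAux (c : K) : OrePoly δ →+ Module.End (constField δ) K :=
  OrePoly.sumHom δ fun i =>
    (LinearMap.toSpanSingleton K (K →ₗ[constField δ] K) (pseudoLinear δ c ^ i)).toAddMonoidHom

theorem evalAux_mono (c : K) (i : ℕ) (a : K) :
    evalAux δ c (OrePoly.mono δ i a) = a • pseudoLinear δ c ^ i :=
  OrePoly.sumHom_mono δ _ i a

theorem evalAux_smul (c a : K) (P : OrePoly δ) : evalAux δ c (a • P) = a • evalAux δ c P := by
  induction P using OrePoly.induction with
  | hadd P P' h h' => simp only [smul_add, _root_.map_add, h, h']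
  | hm i b => rw [OrePoly.smul_mono, evalAux_mono, evalAux_mono, mul_smul]

theorem evalAux_mulX (c : K) (P : OrePoly δ) :
    evalAux δ c (OrePoly.mulX δ P) = pseudoLinear δ c * evalAux δ c P := by
  induction P using OrePoly.induction with
  | hadd P P' h h' => simp only [_root_.map_add, h, h', mul_add]
  | hm i b =>
    rw [OrePoly.mulX_mono, _root_.map_add, evalAux_mono, evalAux_mono, evalAux_mono, pow_succ']
    ext x
    exact (pseudoLinear_smul δ c b ((pseudoLinear δ c ^ i) x)).symm

/-- The evaluation morphism `ev_c : K[X; θ, δ] → End_F(K)`, `P ↦ P(δ + c θ)`. -/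
def evalAt (c : K) : OrePoly δ →+* Module.End (constField δ) K where
  toFun := evalAux δ c
  map_zero' := _root_.map_zero _
  map_add' := _root_.map_add _
  map_one' := by
    change evalAux δ c (OrePoly.mono δ 0 1) = 1
    rw [evalAux_mono, pow_zero, one_smul]
  map_mul' P Q := by
    induction P using OrePoly.induction with
    | hadd P P' h h' => simp only [add_mul, _root_.map_add, h, h']
    | hm i a =>
      rw [OrePoly.mono_mul, evalAux_smul, evalAux_mono, smul_mul_assoc]
      congr 1
      induction i with
      | zero => rw [pow_zero, one_mul]; rfl
      | succ i ih => rw [Function.iterate_succ_apply', evalAux_mulX, ih, pow_succ', mul_assoc]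

theorem evalAt_smul (c a : K) (P : OrePoly δ) : evalAt δ c (a • P) = a • evalAt δ c P :=
  evalAux_smul δ c a P

theorem evalAt_C (c a x : K) : evalAt δ c (OrePoly.C δ a) x = a * x := by
  have h := evalAux_mono δ c 0 a
  rw [pow_zero] at h
  exact congrArg (fun f : Module.End (constField δ) K => f x) h

theorem evalAt_X (c : K) : evalAt δ c (OrePoly.X δ) = pseudoLinear δ c := by
  have h := evalAux_mono δ c 1 1
  rw [pow_one, one_smul] at h
  exact h

/-- `c` is ramified when `δ + c θ` is a scalar multiple of the identity of `K`. -/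
def IsRamified (c : K) : Prop := ∃ l : K, ∀ x, δ x + c * θ x = l * x

end Basic

/-! ### Degree and the skew field of fractions -/

section Fractions

variable {K : Type*} [Field K] {θ : K →+* K} (δ : SkewDerivation θ)

/-- The coefficient of `X ^ n`. -/
def OrePoly.coeff {δ : SkewDerivation θ} (P : OrePoly δ) (n : ℕ) : K :=
  (OrePoly.toPoly δ P).coeff n

/-- The degree (with the convention `0` for the zero polynomial). -/
def OrePoly.natDegree {δ : SkewDerivation θ} (P : OrePoly δ) : ℕ := (OrePoly.toPoly δ P).natDegree

/-- Monic Ore polynomials. -/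
def OrePoly.Monic {δ : SkewDerivation θ} (P : OrePoly δ) : Prop := (OrePoly.toPoly δ P).Monic

/-- The `K`-space `K[X; θ, δ]_{<k}` of Ore polynomials of degree less than `k`. -/
def OrePoly.degreeLT (k : ℕ) : Submodule K (OrePoly δ) :=
  (Polynomial.degreeLT K k).comap (OrePoly.toPoly δ).toLinearMap

variable {δ}

theorem OrePoly.ext_coeff {P Q : OrePoly δ} (h : ∀ n, P.coeff n = Q.coeff n) : P = Q :=
  (OrePoly.toPoly δ).injective (Polynomial.ext h)

theorem OrePoly.coeff_add (P Q : OrePoly δ) (n : ℕ) : (P + Q).coeff n = P.coeff n + Q.coeff n :=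
  Polynomial.coeff_add _ _ _

theorem OrePoly.coeff_sub (P Q : OrePoly δ) (n : ℕ) : (P - Q).coeff n = P.coeff n - Q.coeff n :=
  Polynomial.coeff_sub _ _ _

theorem OrePoly.coeff_smul (a : K) (P : OrePoly δ) (n : ℕ) :
    (a • P).coeff n = a * P.coeff n :=
  Polynomial.coeff_smul _ _ _

theorem OrePoly.coeff_mono (i n : ℕ) (a : K) :
    (OrePoly.mono δ i a).coeff n = if i = n then a else 0 :=
  Polynomial.coeff_monomial

theorem OrePoly.coeff_zero' (n : ℕ) : (0 : OrePoly δ).coeff n = 0 := Polynomial.coeff_zero n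

theorem OrePoly.coeff_sum {ι : Type*} (s : Finset ι) (f : ι → OrePoly δ) (n : ℕ) :
    (∑ i ∈ s, f i).coeff n = ∑ i ∈ s, (f i).coeff n :=
  _root_.map_sum ((Polynomial.lcoeff K n) ∘ₗ (OrePoly.toPoly δ).toLinearMap) f s

theorem OrePoly.coeff_mulX_succ (P : OrePoly δ) (n : ℕ) :
    (OrePoly.mulX δ P).coeff (n + 1) = θ (P.coeff n) + δ (P.coeff (n + 1)) := by
  induction P using OrePoly.induction with
  | hadd P Q hP hQ =>
    simp only [_root_.map_add, OrePoly.coeff_add, hP, hQ, δ.map_add]; ring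
  | hm i a =>
    simp only [OrePoly.mulX_mono, OrePoly.coeff_add, OrePoly.coeff_mono, add_left_inj]
    split_ifs <;> simp [δ.map_zero]

theorem OrePoly.coeff_iterate (Q : OrePoly δ) (q : ℕ) (hq : ∀ m, q < m → Q.coeff m = 0) (i : ℕ) :
    (∀ m, q + i < m → ((OrePoly.mulX δ)^[i] Q).coeff m = 0) ∧
      ((OrePoly.mulX δ)^[i] Q).coeff (q + i) = θ^[i] (Q.coeff q) := by
  induction i with
  | zero => exact ⟨hq, rfl⟩
  | succ i ih =>
    obtain ⟨h1, h2⟩ := ih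
    constructor
    · intro m hm
      obtain ⟨m, rfl⟩ : ∃ m', m = m' + 1 := ⟨m - 1, by omega⟩
      rw [Function.iterate_succ_apply', OrePoly.coeff_mulX_succ, h1 _ (by omega),
        h1 _ (by omega), _root_.map_zero, δ.map_zero, add_zero]
    · rw [Function.iterate_succ_apply', Function.iterate_succ_apply', ← add_assoc,
        OrePoly.coeff_mulX_succ, h2, h1 _ (by omega), δ.map_zero, add_zero]

theorem OrePoly.mul_eq_sum (P Q : OrePoly δ) (p : ℕ) (hp : ∀ m, p < m → P.coeff m = 0) :
    P * Q = ∑ i ∈ Finset.range (p + 1), P.coeff i • (OrePoly.mulX δ)^[i] Q := by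
  change (OrePoly.toPoly δ P).sum (fun i a => a • (OrePoly.mulX δ)^[i] Q) = _
  refine Polynomial.sum_over_range' _ (fun n => zero_smul K ((OrePoly.mulX δ)^[n] Q)) _ ?_
  exact Nat.lt_succ_of_le (Polynomial.natDegree_le_iff_coeff_eq_zero.mpr fun m hm => hp m hm)

theorem OrePoly.coeff_mul_top (P Q : OrePoly δ) (p q : ℕ) (hp : ∀ m, p < m → P.coeff m = 0)
    (hq : ∀ m, q < m → Q.coeff m = 0) :
    (∀ m, p + q < m → (P * Q).coeff m = 0) ∧
      (P * Q).coeff (p + q) = P.coeff p * θ^[p] (Q.coeff q) := by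
  rw [OrePoly.mul_eq_sum P Q p hp]
  constructor
  · intro m hm
    rw [OrePoly.coeff_sum]
    refine Finset.sum_eq_zero fun i hi => ?_
    rw [Finset.mem_range] at hi
    rw [OrePoly.coeff_smul, (OrePoly.coeff_iterate Q q hq i).1 _ (by omega), mul_zero]
  · rw [OrePoly.coeff_sum, Finset.sum_range_succ, Finset.sum_eq_zero, zero_add,
      OrePoly.coeff_smul, add_comm p q, (OrePoly.coeff_iterate Q q hq p).2]
    intro i hi
    rw [Finset.mem_range] at hi
    rw [OrePoly.coeff_smul, (OrePoly.coeff_iterate Q q hq i).1 _ (by omega), mul_zero]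

theorem OrePoly.coeff_eq_zero_of_natDegree_lt (P : OrePoly δ) (m : ℕ) (h : P.natDegree < m) :
    P.coeff m = 0 := Polynomial.coeff_eq_zero_of_natDegree_lt h

theorem OrePoly.coeff_natDegree_ne_zero {P : OrePoly δ} (h : P ≠ 0) : P.coeff P.natDegree ≠ 0 :=
  Polynomial.leadingCoeff_ne_zero.mpr fun h0 => h ((OrePoly.toPoly δ).injective h0)

theorem iterate_ne_zero (n : ℕ) {x : K} (hx : x ≠ 0) : θ^[n] x ≠ 0 := by
  induction n with
  | zero => exact hx
  | succ n ih => rw [Function.iterate_succ_apply']; exact (map_ne_zero θ).mpr ih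

instance : NoZeroDivisors (OrePoly δ) where
  eq_zero_or_eq_zero_of_mul_eq_zero {P Q} h := by
    by_contra hne
    rw [not_or] at hne
    have h2 := (OrePoly.coeff_mul_top P Q _ _ P.coeff_eq_zero_of_natDegree_lt
      Q.coeff_eq_zero_of_natDegree_lt).2
    rw [h, OrePoly.coeff_zero'] at h2
    exact mul_ne_zero (OrePoly.coeff_natDegree_ne_zero hne.1)
      (iterate_ne_zero _ (OrePoly.coeff_natDegree_ne_zero hne.2)) h2.symm

instance : Nontrivial (OrePoly δ) :=
  ⟨1, 0, fun h => by
    have h1 : (OrePoly.mono δ 0 (1 : K)).coeff 0 = (0 : OrePoly δ).coeff 0 :=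
      congrArg (fun P : OrePoly δ => P.coeff 0) h
    rw [OrePoly.coeff_mono, if_pos rfl, OrePoly.coeff_zero'] at h1
    exact one_ne_zero h1⟩

theorem OrePoly.mem_degreeLT {k : ℕ} {P : OrePoly δ} :
    P ∈ OrePoly.degreeLT δ k ↔ ∀ m, k ≤ m → P.coeff m = 0 := by
  rw [OrePoly.degreeLT, Submodule.mem_comap]
  change (OrePoly.toPoly δ P) ∈ _ ↔ _
  rw [Polynomial.mem_degreeLT]
  exact Polynomial.degree_lt_iff_coeff_zero _ _

theorem OrePoly.finrank_degreeLT (k : ℕ) :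
    Module.Finite K (OrePoly.degreeLT δ k) ∧ Module.finrank K (OrePoly.degreeLT δ k) = k := by
  have e : OrePoly.degreeLT δ k ≃ₗ[K] (Fin k → K) :=
    ((OrePoly.toPoly δ).ofSubmodule' (Polynomial.degreeLT K k)).trans
      (Polynomial.degreeLTEquiv K k)
  exact ⟨Module.Finite.equiv e.symm, by rw [e.finrank_eq, Module.finrank_fin_fun]⟩

/-- Right multiplication by `R`, from degree `< k` to degree `< l`. -/
def OrePoly.rmul (R : OrePoly δ) (k l : ℕ) (h : k + R.natDegree ≤ l) :
    OrePoly.degreeLT δ k →ₗ[K] OrePoly.degreeLT δ l where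
  toFun P := ⟨P.1 * R, by
    obtain ⟨P, hP⟩ := P
    rw [OrePoly.mem_degreeLT] at hP ⊢
    intro m hm
    rcases k with _ | k
    · have h0 : P = 0 := OrePoly.ext_coeff fun n => (hP n (Nat.zero_le n)).trans
        (OrePoly.coeff_zero' n).symm
      change (P * R).coeff m = 0
      rw [h0, zero_mul, OrePoly.coeff_zero']
    · exact (OrePoly.coeff_mul_top P R k _ (fun m hm => hP m hm)
        R.coeff_eq_zero_of_natDegree_lt).1 m (by omega)⟩
  map_add' P Q := Subtype.ext (add_mul _ _ _)
  map_smul' a P := Subtype.ext (OrePoly.smul_mul' δ a _ _)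

theorem OrePoly.ore_condition (r s : OrePoly δ) (hs : s ≠ 0) :
    ∃ u v : OrePoly δ, u ≠ 0 ∧ u * r = v * s := by
  set d := max r.natDegree s.natDegree with hd
  have hr' : (d + 1) + r.natDegree ≤ 2 * d + 1 := by have := le_max_left r.natDegree s.natDegree; omega
  have hs' : (d + 1) + s.natDegree ≤ 2 * d + 1 := by have := le_max_right r.natDegree s.natDegree; omega
  have := (OrePoly.finrank_degreeLT (δ := δ) (d + 1)).1
  have := (OrePoly.finrank_degreeLT (δ := δ) (2 * d + 1)).1
  let f : (OrePoly.degreeLT δ (d + 1) × OrePoly.degreeLT δ (d + 1)) →ₗ[K]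
      OrePoly.degreeLT δ (2 * d + 1) :=
    (OrePoly.rmul r _ _ hr').comp (LinearMap.fst K _ _) -
      (OrePoly.rmul s _ _ hs').comp (LinearMap.snd K _ _)
  have hlt : Module.finrank K (OrePoly.degreeLT δ (2 * d + 1)) <
      Module.finrank K (OrePoly.degreeLT δ (d + 1) × OrePoly.degreeLT δ (d + 1)) := by
    rw [Module.finrank_prod, (OrePoly.finrank_degreeLT (δ := δ) _).2,
      (OrePoly.finrank_degreeLT (δ := δ) _).2]
    omega
  obtain ⟨⟨u, v⟩, hmem, hne⟩ := (Submodule.ne_bot_iff _).mp (LinearMap.ker_ne_bot_of_finrank_lt hlt (f := f))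
  have heq : u.1 * r = v.1 * s := by
    have h1 : (OrePoly.rmul r _ _ hr' u) - (OrePoly.rmul s _ _ hs' v) = 0 := hmem
    exact congrArg Subtype.val (sub_eq_zero.mp h1)
  refine ⟨u.1, v.1, fun hu => hne ?_, heq⟩
  rw [hu, zero_mul] at heq
  have hv : v.1 = 0 := (mul_eq_zero.mp heq.symm).resolve_right hs
  exact Prod.ext (Subtype.ext hu) (Subtype.ext hv)

instance : OreLocalization.OreSet (nonZeroDivisors (OrePoly δ)) :=
  Classical.choice <| OreLocalization.nonempty_oreSet_iff_of_noZeroDivisors.mpr fun r s => by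
    obtain ⟨u, v, hu, h⟩ := OrePoly.ore_condition r s.1 (nonZeroDivisors.coe_ne_zero s)
    exact ⟨v, ⟨u, mem_nonZeroDivisors_of_ne_zero hu⟩, h⟩

variable (δ)

/-- The skew field of fractions of `K[X; θ, δ]`. -/
abbrev OreFrac : Type _ := OreLocalization (nonZeroDivisors (OrePoly δ)) (OrePoly δ)

/-- The canonical embedding of `K[X; θ, δ]` in its skew field of fractions. -/
def toFrac : OrePoly δ →+* OreFrac δ := OreLocalization.numeratorRingHom

end Fractions

/-! ### The central polynomial `Z(X)` and the function `υ` -/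

section Centre

theorem exists_twist {K : Type*} [Field K] {θ : K →+* K} (δ : SkewDerivation θ)
    (h : θ ≠ RingHom.id K) : ∃ a : K, ∀ x, δ x = a * (θ x - x) := by
  obtain ⟨y, hy⟩ : ∃ y, θ y ≠ y := by
    by_contra hc
    push Not at hc
    exact h (RingHom.ext hc)
  have hy' : θ y - y ≠ 0 := sub_ne_zero.mpr hy
  refine ⟨δ y / (θ y - y), fun x => ?_⟩
  have h1 := δ.leibniz x y
  have h2 := δ.leibniz y x
  rw [mul_comm y x, h1] at h2
  rw [div_mul_eq_mul_div, eq_div_iff hy']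
  linear_combination -h2

variable {K : Type*} [Field K] {θ : K →+* K} (δ : SkewDerivation θ)

/-- For `θ ≠ id`, the element `a` of `K` with `δ = a (θ - id)`. -/
def twist (h : θ ≠ RingHom.id K) : K := Classical.choose (exists_twist δ h)

theorem twist_spec (h : θ ≠ RingHom.id K) (x : K) : δ x = twist δ h * (θ x - x) :=
  Classical.choose_spec (exists_twist δ h) x

theorem evalAt_map (p : (constField δ)[X]) :
    evalAt δ 0 ((OrePoly.toPoly δ).symm (p.map (algebraMap (constField δ) K))) =
      Polynomial.aeval (pseudoLinear δ 0) p := by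
  induction p using Polynomial.induction_on' with
  | add p q hp hq => simp only [Polynomial.map_add, _root_.map_add, hp, hq]
  | monomial i a =>
    rw [Polynomial.map_monomial, Polynomial.aeval_monomial]
    refine (evalAux_mono δ 0 i _).trans ?_
    ext x
    rfl

theorem exists_annihilator [FiniteDimensional (constField δ) K] :
    ∃ P : OrePoly δ, P.Monic ∧ evalAt δ 0 P = 0 ∧
      ∀ Q : OrePoly δ, Q.Monic → evalAt δ 0 Q = 0 → P.natDegree ≤ Q.natDegree := by
  let S : Set (OrePoly δ) := {P | P.Monic ∧ evalAt δ 0 P = 0}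
  have hS : S.Nonempty := by
    refine ⟨(OrePoly.toPoly δ).symm ((minpoly (constField δ) (pseudoLinear δ 0)).map
      (algebraMap (constField δ) K)), ?_, ?_⟩
    · exact (minpoly.monic (Algebra.IsIntegral.isIntegral _)).map _
    · rw [evalAt_map, minpoly.aeval]
  obtain ⟨P, hP, hmin⟩ := WellFounded.has_min (measure (OrePoly.natDegree (δ := δ))).wf S hS
  exact ⟨P, hP.1, hP.2, fun Q h1 h2 => not_lt.mp (hmin Q ⟨h1, h2⟩)⟩

theorem exists_remainder (c : K) (P : OrePoly δ) :
    ∃ (r : K) (Q : OrePoly δ), P = Q * (OrePoly.X δ - OrePoly.C δ c) + OrePoly.C δ r := by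
  induction P using OrePoly.induction with
  | hadd P P' h h' =>
    obtain ⟨r, Q, hQ⟩ := h
    obtain ⟨r', Q', hQ'⟩ := h'
    refine ⟨r + r', Q + Q', ?_⟩
    rw [hQ, hQ', add_mul, _root_.map_add]; abel
  | hm i a =>
    induction i generalizing a with
    | zero => exact ⟨a, 0, by rw [zero_mul, zero_add]; rfl⟩
    | succ i ih =>
      obtain ⟨r, Q, hQ⟩ := ih 1
      refine ⟨a * (θ r * c + δ r),
        OrePoly.C δ a * (OrePoly.X δ * Q + OrePoly.C δ (θ r)), ?_⟩
      rw [OrePoly.mono_eq, _root_.map_one, one_mul] at hQ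
      rw [OrePoly.mono_eq, pow_succ', hQ, mul_add (OrePoly.X δ), OrePoly.X_mul_C,
        _root_.map_mul (OrePoly.C δ) a, _root_.map_add (OrePoly.C δ) (θ r * c),
        _root_.map_mul (OrePoly.C δ) (θ r)]
      noncomm_ring

theorem X_add_twist_comm (h : θ ≠ RingHom.id K) (b : K) :
    (OrePoly.X δ + OrePoly.C δ (twist δ h)) * OrePoly.C δ b =
      OrePoly.C δ (θ b) * (OrePoly.X δ + OrePoly.C δ (twist δ h)) := by
  rw [add_mul, mul_add, OrePoly.X_mul_C, twist_spec δ h b, ← _root_.map_mul, ← _root_.map_mul,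
    add_assoc, ← _root_.map_add]
  congr 2
  ring

theorem X_add_twist_pow_comm (h : θ ≠ RingHom.id K) (n : ℕ) (b : K) :
    (OrePoly.X δ + OrePoly.C δ (twist δ h)) ^ n * OrePoly.C δ b =
      OrePoly.C δ ((θ ^ n) b) * (OrePoly.X δ + OrePoly.C δ (twist δ h)) ^ n := by
  induction n with
  | zero => simp
  | succ n ih =>
    rw [pow_succ', mul_assoc, ih, ← mul_assoc, X_add_twist_comm, mul_assoc, pow_succ' θ]
    rfl

variable [FiniteDimensional (constField δ) K]

/-- The monic polynomial `P` of minimal degree with coefficients in `K` such that `P(δ) = 0`. -/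
def minAnnihilator : OrePoly δ := Classical.choose (exists_annihilator δ)

open scoped Classical in
/-- The normalized central polynomial `Z(X)`: the minimal polynomial of `δ` if `θ = id`, and
`(X + a) ^ s` if `θ ≠ id`, where `δ = a (θ - id)` and `s` is the order of `θ`. -/
def centralZ : OrePoly δ :=
  if h : θ = RingHom.id K then minAnnihilator δ
  else (OrePoly.X δ + OrePoly.C δ (twist δ h)) ^ orderOf θ

theorem minAnnihilator_comm (h : θ = RingHom.id K) (b : K) :
    minAnnihilator δ * OrePoly.C δ b = OrePoly.C δ b * minAnnihilator δ := by
  obtain ⟨h1, h2, h3⟩ := Classical.choose_spec (exists_annihilator δ)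
  change (minAnnihilator δ).Monic at h1
  change evalAt δ 0 (minAnnihilator δ) = 0 at h2
  change ∀ Q : OrePoly δ, Q.Monic → evalAt δ 0 Q = 0 →
    (minAnnihilator δ).natDegree ≤ Q.natDegree at h3
  set Z := minAnnihilator δ with hZ
  by_contra hne
  set W := Z * OrePoly.C δ b - OrePoly.C δ b * Z with hW
  have hW0 : W ≠ 0 := sub_ne_zero.mpr hne
  have hb : ∀ m, 0 < m → (OrePoly.C δ b).coeff m = 0 := fun m hm => by
    change (OrePoly.mono δ 0 b).coeff m = 0
    rw [OrePoly.coeff_mono, if_neg (by omega)]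
  have hb0 : (OrePoly.C δ b).coeff 0 = b := by
    change (OrePoly.mono δ 0 b).coeff 0 = b
    rw [OrePoly.coeff_mono, if_pos rfl]
  have htop := OrePoly.coeff_mul_top Z (OrePoly.C δ b) _ 0 Z.coeff_eq_zero_of_natDegree_lt hb
  have hZ1 : Z.coeff Z.natDegree = 1 := h1
  have hcoeff : ∀ m, Z.natDegree ≤ m → W.coeff m = 0 := by
    intro m hm
    rw [hW, OrePoly.coeff_sub, OrePoly.C_mul, OrePoly.coeff_smul]
    rcases hm.eq_or_lt with rfl | hm
    · have h4 := htop.2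
      rw [add_zero] at h4
      have hit : θ^[Z.natDegree] b = b := by
        exact Function.iterate_fixed (by rw [h]; rfl) _
      rw [h4, hZ1, hb0, hit, one_mul, mul_one, sub_self]
    · rw [htop.1 m (by omega), Z.coeff_eq_zero_of_natDegree_lt m hm, mul_zero, sub_zero]
  have hlt : W.natDegree < Z.natDegree := by
    by_contra hge
    exact OrePoly.coeff_natDegree_ne_zero hW0 (hcoeff _ (not_lt.mp hge))
  have hev : evalAt δ 0 W = 0 := by
    rw [hW, _root_.map_sub, _root_.map_mul, _root_.map_mul, h2, zero_mul, mul_zero, sub_zero]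
  have hl := OrePoly.coeff_natDegree_ne_zero hW0
  set l := W.coeff W.natDegree with hldef
  have hmon : (l⁻¹ • W).Monic := by
    change (OrePoly.toPoly δ (l⁻¹ • W)).Monic
    rw [_root_.map_smul, Polynomial.smul_eq_C_mul, mul_comm]
    exact Polynomial.monic_mul_leadingCoeff_inv
      fun h0 => hW0 ((OrePoly.toPoly δ).injective h0)
  have hle := h3 _ hmon (by rw [evalAt_smul, hev, smul_zero])
  have hdeg : (l⁻¹ • W).natDegree ≤ W.natDegree := Polynomial.natDegree_smul_le _ _
  omega

theorem centralZ_comm (b : K) :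
    centralZ δ * OrePoly.C δ b = OrePoly.C δ b * centralZ δ := by
  unfold centralZ
  split_ifs with h
  · exact minAnnihilator_comm δ h b
  · rw [X_add_twist_pow_comm, pow_orderOf_eq_one]; rfl

/-- `υ(c)`: the remainder (in `K`) of the right Euclidean division of `Z(X)` by `X - c`. -/
def upsilon (c : K) : K := Classical.choose (exists_remainder δ c (centralZ δ))

theorem upsilon_spec (c : K) : ∃ Q : OrePoly δ,
    centralZ δ = Q * (OrePoly.X δ - OrePoly.C δ c) + OrePoly.C δ (upsilon δ c) :=
  Classical.choose_spec (exists_remainder δ c (centralZ δ))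

/-- `N_c = Z(X) - υ(c)`. -/
def modulus (c : K) : OrePoly δ := centralZ δ - OrePoly.C δ (upsilon δ c)

theorem evalAt_modulus (c : K) : evalAt δ c (modulus δ c) = 0 := by
  have h1 : evalAt δ c (modulus δ c) 1 = 0 := by
    obtain ⟨Q, hQ⟩ := upsilon_spec δ c
    rw [modulus, hQ, add_sub_cancel_right, _root_.map_mul, Module.End.mul_apply, _root_.map_sub,
      evalAt_X, LinearMap.sub_apply, evalAt_C]
    have h : pseudoLinear δ c 1 = c := by
      change δ 1 + c * θ 1 = c
      rw [δ.map_one, _root_.map_one, zero_add, mul_one]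
    rw [h, mul_one, sub_self, _root_.map_zero]
  have hcomm (b : K) : modulus δ c * OrePoly.C δ b = OrePoly.C δ b * modulus δ c := by
    rw [modulus, sub_mul, mul_sub, centralZ_comm, ← _root_.map_mul, ← _root_.map_mul, mul_comm b]
  ext b
  have h2 : evalAt δ c (OrePoly.C δ b) 1 = b := by rw [evalAt_C, mul_one]
  calc evalAt δ c (modulus δ c) b
      = evalAt δ c (modulus δ c * OrePoly.C δ b) 1 := by
        rw [_root_.map_mul, Module.End.mul_apply, h2]
    _ = b * evalAt δ c (modulus δ c) 1 := by
        rw [hcomm, _root_.map_mul, Module.End.mul_apply, evalAt_C]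
    _ = 0 := by rw [h1, mul_zero]

end Centre

/-! ### Taylor expansions and skew residues -/

section Residues

variable {K : Type*} [Field K] {θ : K →+* K} (δ : SkewDerivation θ)
  [FiniteDimensional (constField δ) K]

/-- The two-sided ideal generated by `N_c ^ m`. -/
def modIdeal (c : K) (m : ℕ) : TwoSidedIdeal (OrePoly δ) := TwoSidedIdeal.span {modulus δ c ^ m}

/-- The quotient of `K[X; θ, δ]` by `N_c ^ m`. -/
abbrev QuotPow (c : K) (m : ℕ) : Type _ := (modIdeal δ c m).ringCon.Quotient

/-- The projection to the quotient by `N_c ^ m`. -/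
def toQuotPow (c : K) (m : ℕ) : OrePoly δ →+* QuotPow δ c m := (modIdeal δ c m).ringCon.mk'

/-- The residue ring: the quotient of `K[X; θ, δ]` by `N_c` (that is, by `N_c ^ 1`). -/
abbrev ResRing (c : K) : Type _ := QuotPow δ c 1

/-- The inverse limit of the quotients of `K[X; θ, δ]` by the powers of `N_c`: families `x` such
that `x m` is the image of `x (m + 1)` under the transition map (that is, both are the class of a
common Ore polynomial). -/
def Completion (c : K) : Subring (∀ m : ℕ, QuotPow δ c m) where
  carrier := {x | ∀ m, ∃ f : OrePoly δ,
    toQuotPow δ c m f = x m ∧ toQuotPow δ c (m + 1) f = x (m + 1)}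
  mul_mem' {x y} hx hy m := by
    obtain ⟨f, hf, hf'⟩ := hx m
    obtain ⟨g, hg, hg'⟩ := hy m
    exact ⟨f * g, by rw [_root_.map_mul, hf, hg]; rfl, by rw [_root_.map_mul, hf', hg']; rfl⟩
  one_mem' m := ⟨1, _root_.map_one _, _root_.map_one _⟩
  add_mem' {x y} hx hy m := by
    obtain ⟨f, hf, hf'⟩ := hx m
    obtain ⟨g, hg, hg'⟩ := hy m
    exact ⟨f + g, by rw [_root_.map_add, hf, hg]; rfl, by rw [_root_.map_add, hf', hg']; rfl⟩
  zero_mem' m := ⟨0, _root_.map_zero _, _root_.map_zero _⟩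
  neg_mem' {x} hx m := by
    obtain ⟨f, hf, hf'⟩ := hx m
    exact ⟨-f, by rw [_root_.map_neg, hf]; rfl, by rw [_root_.map_neg, hf']; rfl⟩

/-- The canonical map from `K[X; θ, δ]` to its `N_c`-adic completion. -/
def toCompletion (c : K) : OrePoly δ →+* Completion δ c :=
  (RingHom.codRestrict (RingHom.pi fun m => toQuotPow δ c m) (Completion δ c)
    fun f _ => ⟨f, rfl, rfl⟩)

/-- A `z`-admissible isomorphism, for `z = υ(c)`: an isomorphism of `K`-algebras from the
`N_c`-adic completion of `K[X; θ, δ]` to the power series over the residue ring, mapping `N_c` to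
`T` and inducing the identity modulo `N_c` on the left and modulo `T` on the right. -/
structure AdmissibleIso (c : K) extends Completion δ c ≃+* PowerSeries (ResRing δ c) where
  map_const : ∀ a : K, toFun (toCompletion δ c (OrePoly.C δ a)) =
    PowerSeries.C (toQuotPow δ c 1 (OrePoly.C δ a))
  map_modulus : toFun (toCompletion δ c (modulus δ c)) = PowerSeries.X
  reduction : ∀ x : Completion δ c, PowerSeries.constantCoeff (toFun x) = x.1 1

/-- A Taylor expansion morphism `TS_z` at `z = υ(c)`: an admissible isomorphism together with the
extension to the skew field of fractions, with values in Laurent series, of the map it induces on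
`K[X; θ, δ]`. -/
structure TaylorExpansion (c : K) where
  iso : AdmissibleIso δ c
  toLaurent : OreFrac δ →+* LaurentSeries (ResRing δ c)
  extends_iso : ∀ f : OrePoly δ, toLaurent (toFrac δ f) =
    HahnSeries.ofPowerSeries ℤ (ResRing δ c) (iso.toFun (toCompletion δ c f))

variable {δ} in
/-- The skew residue at `z = υ(c)`: the coefficient of `T ^ (-1)` in the Taylor expansion. -/
def TaylorExpansion.sres {c : K} (TS : TaylorExpansion δ c) (f : OreFrac δ) : ResRing δ c :=
  (TS.toLaurent f).coeff (-1)

/-- The evaluation morphism `ev_c`, induced on the residue ring. -/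
def evalRes (c : K) : ResRing δ c →+* Module.End (constField δ) K :=
  (modIdeal δ c 1).ringCon.lift (evalAt δ c) (by
    have h : modIdeal δ c 1 ≤ TwoSidedIdeal.ker (evalAt δ c) := by
      rw [modIdeal, TwoSidedIdeal.span_le, Set.singleton_subset_iff, pow_one]
      exact (TwoSidedIdeal.mem_ker _).mpr (evalAt_modulus δ c)
    intro x y hxy
    exact TwoSidedIdeal.ringCon_le_iff.mp h hxy)

theorem evalRes_mk (c : K) (f : OrePoly δ) : evalRes δ c (toQuotPow δ c 1 f) = evalAt δ c f := rfl

variable {δ} in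
theorem TaylorExpansion.sres_add {c : K} (TS : TaylorExpansion δ c) (f g : OreFrac δ) :
    TS.sres (f + g) = TS.sres f + TS.sres g := by
  unfold TaylorExpansion.sres
  rw [_root_.map_add]; rfl

variable {δ} in
theorem TaylorExpansion.sres_const_mul {c : K} (TS : TaylorExpansion δ c) (a : K) (f : OreFrac δ) :
    TS.sres (toFrac δ (OrePoly.C δ a) * f) = toQuotPow δ c 1 (OrePoly.C δ a) * TS.sres f := by
  unfold TaylorExpansion.sres
  rw [_root_.map_mul, TS.extends_iso, TS.iso.map_const, HahnSeries.ofPowerSeries_C,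
    HahnSeries.C_mul_eq_smul]
  rfl

theorem evalRes_const_mul (c a : K) (r : ResRing δ c) :
    evalRes δ c (toQuotPow δ c 1 (OrePoly.C δ a) * r) = a • evalRes δ c r := by
  rw [_root_.map_mul, evalRes_mk]
  ext x
  rw [Module.End.mul_apply, evalAt_C]; rfl

end Residues

/-! ### Codes in the sum-rank metric -/

section Codes

variable {F K : Type*} [Field F] [Field K] [Algebra F K] {m : ℕ}
  {U : Fin m → Type*} [∀ i, AddCommGroup (U i)] [∀ i, Module F (U i)]

/-- The sum-rank weight of `(φ₁, …, φₘ)`, with `φᵢ` in `Hom_F(Uᵢ, K)`. -/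
def sumRankWeight (φ : ∀ i, U i →ₗ[F] K) : ℕ := ∑ i, Module.finrank F (LinearMap.range (φ i))

/-- The length of a code in `∏ Hom_F(Uᵢ, K)`. -/
def codeLength (_C : Submodule K (∀ i, U i →ₗ[F] K)) : ℕ := ∑ i, Module.finrank F (U i)

/-- `d` is the minimal sum-rank distance of `C`: the minimal weight of a nonzero element. -/
def IsMinDistance (C : Submodule K (∀ i, U i →ₗ[F] K)) (d : ℕ) : Prop :=
  IsLeast {w | ∃ φ ∈ C, φ ≠ 0 ∧ sumRankWeight φ = w} d

/-- `C` is MSRD: it attains the Singleton bound `dimension + distance ≤ length + 1`. -/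
def IsMSRD (C : Submodule K (∀ i, U i →ₗ[F] K)) : Prop :=
  ∃ d, IsMinDistance C d ∧ Module.finrank K C + d = codeLength C + 1

end Codes

/-! ### Linearized Goppa codes -/

section Goppa

variable {K : Type*} [Field K] {θ : K →+* K} (δ : SkewDerivation θ)
  [FiniteDimensional (constField δ) K] {m : ℕ}

/-- `n = ∑ dim_F K / Vᵢ`. -/
def codim (V : Fin m → Submodule (constField δ) K) : ℕ :=
  ∑ i, Module.finrank (constField δ) (K ⧸ V i)

/-- The defining property of the polynomial `D`: monic of degree `∑ dim_F K / Vᵢ`, and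
the image of `ev_{cᵢ}(D)` is `Vᵢ` for all `i`. -/
def IsGoppaDivisor (c : Fin m → K) (V : Fin m → Submodule (constField δ) K) (D : OrePoly δ) :
    Prop :=
  D.Monic ∧ D.natDegree = codim δ V ∧ ∀ i, LinearMap.range (evalAt δ (c i) D) = V i

/-- The polynomial `D` attached to `c` and `V`: the monic Ore polynomial of degree
`∑ dim_F K / Vᵢ` such that the image of `ev_{cᵢ}(D)` is `Vᵢ` for all `i`. -/
def goppaDivisor (c : Fin m → K) (V : Fin m → Submodule (constField δ) K) : OrePoly δ :=
  Classical.epsilon (IsGoppaDivisor δ c V)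

open scoped Classical in
/-- The element `P` of the skew field of fractions: `D⁻¹` if `θ = id`, and
`Z(X) ^ (- m - 1) (X + a) ^ (n - k) D⁻¹` if `θ ≠ id` and `δ = a (θ - id)`. -/
def goppaFactor (k : ℕ) (c : Fin m → K) (V : Fin m → Submodule (constField δ) K) : OreFrac δ :=
  if h : θ = RingHom.id K then (toFrac δ (goppaDivisor δ c V))⁻¹
  else (toFrac δ (centralZ δ)) ^ (-(m : ℤ) - 1) *
    toFrac δ (OrePoly.X δ + OrePoly.C δ (twist δ h)) ^ ((codim δ V : ℤ) - k) *
    (toFrac δ (goppaDivisor δ c V))⁻¹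

variable {δ} in
/-- The map `γ`, before passing to the quotients `K / Vᵢ`:
`f ↦ (ev_{cᵢ}(sres_{zᵢ}(f)))ᵢ` with `zᵢ = υ(cᵢ)`. -/
def goppaGamma {c : Fin m → K} (TS : ∀ i, TaylorExpansion δ (c i)) (f : OreFrac δ) (i : Fin m) :
    Module.End (constField δ) K :=
  evalRes δ (c i) ((TS i).sres f)

variable {δ} in
/-- The linearized Goppa code `LG(k, c, V)` in `∏ Hom_F(K / Vᵢ, K)`: the image under `γ` of the
space of all `g P` with `deg g < k`, an element of `Hom_F(K / Vᵢ, K)` being identified with the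
endomorphism of `K` it induces. -/
def goppaCode (k : ℕ) {c : Fin m → K} (V : Fin m → Submodule (constField δ) K)
    (TS : ∀ i, TaylorExpansion δ (c i)) :
    Submodule K (∀ i, (K ⧸ V i) →ₗ[constField δ] K) where
  carrier := {φ | ∃ g ∈ OrePoly.degreeLT δ k, ∀ i,
    φ i ∘ₗ (V i).mkQ = goppaGamma TS (toFrac δ g * goppaFactor δ k c V) i}
  add_mem' := by
    rintro φ ψ ⟨g, hg, h⟩ ⟨g', hg', h'⟩
    refine ⟨g + g', Submodule.add_mem _ hg hg', fun i => ?_⟩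
    rw [Pi.add_apply, LinearMap.add_comp, h, h', _root_.map_add, add_mul]
    unfold goppaGamma
    rw [TaylorExpansion.sres_add, _root_.map_add]
  zero_mem' := by
    refine ⟨0, Submodule.zero_mem _, fun i => ?_⟩
    unfold goppaGamma TaylorExpansion.sres
    rw [_root_.map_zero, zero_mul, _root_.map_zero]
    exact (_root_.map_zero (evalRes δ (c i))).symm
  smul_mem' := by
    rintro a φ ⟨g, hg, h⟩
    refine ⟨a • g, Submodule.smul_mem _ a hg, fun i => ?_⟩
    rw [Pi.smul_apply, LinearMap.smul_comp, h, ← OrePoly.C_mul, _root_.map_mul, mul_assoc]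
    unfold goppaGamma
    rw [TaylorExpansion.sres_const_mul, evalRes_const_mul]

end Goppa

end OreCode

end

namespace OreCode

/-! ### Degrees, right Euclidean division and the universal property of Ore polynomials. -/

section OreBasics

variable {K : Type*} [Field K] {θ : K →+* K} {δ : SkewDerivation θ}

/-! Let d = [K:F]. Everything rests on a root count: at an unramified point the kernel of ev_c(f)
has F-dimension at most deg f (`finrank_ker_evalAt_le`). Hence ev_c maps onto End_F(K), with kernel
generated by the central polynomial N = Z(X) - z, of degree d. Lagrange interpolation in Z(X) then
shows that the kernels of f at several points with distinct z_i have total dimension at most deg f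
(`sum_finrank_le_natDegree`).

Taylor expansions come from deforming ev_c into X ↦ δ + (c + g t)θ. The image of N is a polynomial
in t over F without constant term. For a suitable g its linear coefficient is nonzero, since
otherwise the first-order part of the deformation would be an inner derivation of End_F(K)
(`exists_coeff_one_deform_ne_zero`). Substituting for t the inverse series sends N to T
(`exists_taylor_end`). The map extends to the completion, and also to fractions, because every
nonzero f divides some nonzero p(Z) (`exists_mul_eq_centralHom`), which becomes a power of T times a
unit.

For the code, put M = ∏ (Z - z_i), a central polynomial of degree md. It factors as M = D D'
(`IsGoppaDivisor.exists_cofactor`), so gP has at most simple poles at the z_i. Its residues there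
are, up to nonzero constants of F and whatever the expansions, ev_{c_i}(gB) with B = D' if θ = id
and B = (X + a)^{n-k} D' otherwise (`exists_goppaGamma_eq`). In the first case deg(gB) < k + md - n,
so the kernels total at most k + md - n - 1 and the ranks at least n - k + 1. In the second case,
multiplying on the left by a power of X + a turns (X + a)^{n-k} into a power of Z, which acts by
nonzero scalars, and the same bound follows. The bound makes g ↦ codeword injective, whence the
dimension k; the Singleton argument (`exists_sumRankWeight_le`) gives the opposite inequality for
the distance. -/

theorem OrePoly.natDegree_mul {P Q : OrePoly δ} (hP : P ≠ 0) (hQ : Q ≠ 0) :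
    (P * Q).natDegree = P.natDegree + Q.natDegree := by
  obtain ⟨h1, h2⟩ := OrePoly.coeff_mul_top P Q _ _ P.coeff_eq_zero_of_natDegree_lt
    Q.coeff_eq_zero_of_natDegree_lt
  refine le_antisymm (Polynomial.natDegree_le_iff_coeff_eq_zero.mpr fun m hm => h1 m hm)
    (Polynomial.le_natDegree_of_ne_zero ?_)
  change (P * Q).coeff _ ≠ 0
  rw [h2]
  exact mul_ne_zero (OrePoly.coeff_natDegree_ne_zero hP)
    (iterate_ne_zero _ (OrePoly.coeff_natDegree_ne_zero hQ))

theorem OrePoly.Monic.ne_zero {P : OrePoly δ} (hP : P.Monic) : P ≠ 0 := by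
  rintro rfl
  exact Polynomial.Monic.ne_zero hP rfl

theorem OrePoly.mem_degreeLT_iff {P : OrePoly δ} (hP : P ≠ 0) {k : ℕ} :
    P ∈ OrePoly.degreeLT δ k ↔ P.natDegree < k := by
  rw [OrePoly.mem_degreeLT]
  constructor
  · intro h
    by_contra hk
    exact OrePoly.coeff_natDegree_ne_zero hP (h _ (not_lt.mp hk))
  · intro h m hm
    exact P.coeff_eq_zero_of_natDegree_lt m (h.trans_le hm)

theorem OrePoly.degreeLT_mono {k l : ℕ} (h : k ≤ l) :
    OrePoly.degreeLT δ k ≤ OrePoly.degreeLT δ l := fun P hP => by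
  rw [OrePoly.mem_degreeLT] at hP ⊢
  exact fun m hm => hP m (h.trans hm)

theorem OrePoly.C_mem_degreeLT (a : K) {k : ℕ} (hk : 0 < k) :
    OrePoly.C δ a ∈ OrePoly.degreeLT δ k := by
  rw [OrePoly.mem_degreeLT]
  intro m hm
  change (OrePoly.mono δ 0 a).coeff m = 0
  rw [OrePoly.coeff_mono, if_neg (by omega)]

theorem OrePoly.natDegree_C (a : K) : (OrePoly.C δ a).natDegree = 0 := Polynomial.natDegree_C a

theorem OrePoly.natDegree_X_add_C (a : K) : (OrePoly.X δ + OrePoly.C δ a).natDegree = 1 :=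
  (congrArg Polynomial.natDegree (by
    change (Polynomial.monomial 1 1 : K[X]) + Polynomial.monomial 0 a =
      Polynomial.X + Polynomial.C a
    rfl)).trans (Polynomial.natDegree_X_add_C a)

theorem OrePoly.X_add_C_ne_zero (a : K) : OrePoly.X δ + OrePoly.C δ a ≠ 0 := by
  intro h
  have h1 := OrePoly.natDegree_X_add_C (δ := δ) a
  rw [h] at h1
  exact zero_ne_one h1

theorem OrePoly.natDegree_pow {P : OrePoly δ} (hP : P ≠ 0) (n : ℕ) :
    (P ^ n).natDegree = n * P.natDegree := by
  induction n with
  | zero => rw [pow_zero, zero_mul]; exact OrePoly.natDegree_C 1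
  | succ n ih => rw [pow_succ, OrePoly.natDegree_mul (pow_ne_zero n hP) hP, ih, Nat.succ_mul]

theorem OrePoly.natDegree_lt_of_coeff {P : OrePoly δ} (hP : P ≠ 0) {n : ℕ}
    (h : ∀ m, n ≤ m → P.coeff m = 0) : P.natDegree < n :=
  (OrePoly.mem_degreeLT_iff hP).mp (OrePoly.mem_degreeLT.mpr h)

/-- Right Euclidean division. -/
theorem OrePoly.exists_div (f : OrePoly δ) (hf : f ≠ 0) (h : OrePoly δ) :
    ∃ q r : OrePoly δ, h = q * f + r ∧ r ∈ OrePoly.degreeLT δ f.natDegree := by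
  obtain ⟨n, hn⟩ : ∃ n, h ∈ OrePoly.degreeLT δ n :=
    ⟨h.natDegree + 1, OrePoly.mem_degreeLT.mpr fun m hm =>
      h.coeff_eq_zero_of_natDegree_lt m (by omega)⟩
  induction n generalizing h with
  | zero =>
    refine ⟨0, h, by rw [zero_mul, zero_add], OrePoly.degreeLT_mono (Nat.zero_le _) hn⟩
  | succ n ih =>
    by_cases hle : n + 1 ≤ f.natDegree
    · exact ⟨0, h, by rw [zero_mul, zero_add], OrePoly.degreeLT_mono hle hn⟩
    obtain ⟨j, rfl⟩ : ∃ j, n = j + f.natDegree := ⟨n - f.natDegree, by omega⟩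
    rw [OrePoly.mem_degreeLT] at hn
    have hl : θ^[j] (f.coeff f.natDegree) ≠ 0 :=
      iterate_ne_zero _ (OrePoly.coeff_natDegree_ne_zero hf)
    -- Multiplying by X ^ j on the left twists the leading coefficient of f by θ^j, hence the
    -- denominator.
    set q0 : OrePoly δ := OrePoly.mono δ j (h.coeff (j + f.natDegree) /
      θ^[j] (f.coeff f.natDegree)) with hq0
    have htop := OrePoly.coeff_mul_top q0 f j _ (fun m hm => by
      rw [hq0, OrePoly.coeff_mono, if_neg (by omega)]) f.coeff_eq_zero_of_natDegree_lt
    have hq0j : q0.coeff j = h.coeff (j + f.natDegree) / θ^[j] (f.coeff f.natDegree) := by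
      rw [hq0, OrePoly.coeff_mono, if_pos rfl]
    obtain ⟨q, r, hqr, hr⟩ := ih (h - q0 * f) (by
      rw [OrePoly.mem_degreeLT]
      intro m hm
      rw [OrePoly.coeff_sub]
      rcases hm.eq_or_lt with rfl | hm
      · rw [htop.2, hq0j, div_mul_cancel₀ _ hl, sub_self]
      · rw [htop.1 m hm, hn m hm, sub_zero])
    exact ⟨q0 + q, r, by rw [add_mul, add_assoc, ← hqr]; abel, hr⟩

theorem OrePoly.smul_monic {P : OrePoly δ} (hP : P ≠ 0) :
    ∃ a : K, a ≠ 0 ∧ (a • P).Monic ∧ (a • P).natDegree = P.natDegree := by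
  have h := OrePoly.coeff_natDegree_ne_zero hP
  refine ⟨(P.coeff P.natDegree)⁻¹, inv_ne_zero h, ?_,
    Polynomial.natDegree_smul _ (inv_ne_zero h)⟩
  change (OrePoly.toPoly δ (_ • P)).Monic
  rw [_root_.map_smul, Polynomial.smul_eq_C_mul, mul_comm]
  exact Polynomial.monic_mul_leadingCoeff_inv
    fun h0 => hP ((OrePoly.toPoly δ).injective h0)

theorem OrePoly.Monic.of_mul_left {P Q : OrePoly δ} (hPQ : (P * Q).Monic) (hQ : Q.Monic) :
    P.Monic := by
  have h0 := hPQ.ne_zero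
  have hP : P ≠ 0 := left_ne_zero_of_mul h0
  have hdeg := OrePoly.natDegree_mul hP hQ.ne_zero
  have h2 := (OrePoly.coeff_mul_top P Q _ _ P.coeff_eq_zero_of_natDegree_lt
    Q.coeff_eq_zero_of_natDegree_lt).2
  rw [← hdeg] at h2
  have h3 : (P * Q).coeff (P * Q).natDegree = 1 := hPQ
  have h4 : Q.coeff Q.natDegree = 1 := hQ
  rw [h3, h4, iterate_map_one, mul_one] at h2
  exact h2.symm

/-- An Ore polynomial commuting with the constants and with `X` is central. -/
theorem OrePoly.commute_of_commute_gen {Z : OrePoly δ}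
    (hC : ∀ b, Z * OrePoly.C δ b = OrePoly.C δ b * Z)
    (hX : Z * OrePoly.X δ = OrePoly.X δ * Z) (P : OrePoly δ) : Commute Z P := by
  induction P using OrePoly.induction with
  | hadd P Q hP hQ => exact hP.add_right hQ
  | hm i a =>
    rw [OrePoly.mono_eq]
    exact Commute.mul_right (hC a) (Commute.pow_right hX i)

/-- Right multiplication by X is a plain shift, whereas left multiplication involves θ and δ;
comparing the two shows that Z(X) commutes with X. -/
theorem OrePoly.coeff_mul_X_succ (P : OrePoly δ) (n : ℕ) :
    (P * OrePoly.X δ).coeff (n + 1) = P.coeff n := by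
  induction P using OrePoly.induction with
  | hadd P Q hP hQ => rw [add_mul, OrePoly.coeff_add, OrePoly.coeff_add, hP, hQ]
  | hm i a =>
    rw [OrePoly.mono_eq, mul_assoc, ← pow_succ, ← OrePoly.mono_eq, ← OrePoly.mono_eq,
      OrePoly.coeff_mono, OrePoly.coeff_mono]
    simp only [add_left_inj]

theorem OrePoly.ringHom_ext {S : Type*} [Ring S] {f g : OrePoly δ →+* S}
    (hC : ∀ b, f (OrePoly.C δ b) = g (OrePoly.C δ b)) (hX : f (OrePoly.X δ) = g (OrePoly.X δ)) :
    f = g := by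
  ext P
  induction P using OrePoly.induction with
  | hadd P Q hP hQ => rw [_root_.map_add, _root_.map_add, hP, hQ]
  | hm i a => rw [OrePoly.mono_eq, _root_.map_mul, _root_.map_mul, _root_.map_pow,
      _root_.map_pow, hC, hX]

section Lift

variable {S : Type*} [Ring S] (f : K →+* S) (ξ : S)

/-- The additive map underlying `OrePoly.lift`. -/
noncomputable def OrePoly.liftAux : OrePoly δ →+ S :=
  OrePoly.sumHom δ fun i => (AddMonoidHom.mulRight (ξ ^ i)).comp f.toAddMonoidHom

theorem OrePoly.liftAux_mono (i : ℕ) (a : K) :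
    OrePoly.liftAux (δ := δ) f ξ (OrePoly.mono δ i a) = f a * ξ ^ i :=
  OrePoly.sumHom_mono δ _ i a

theorem OrePoly.liftAux_smul (a : K) (P : OrePoly δ) :
    OrePoly.liftAux f ξ (a • P) = f a * OrePoly.liftAux f ξ P := by
  induction P using OrePoly.induction with
  | hadd P Q hP hQ => rw [smul_add, _root_.map_add, _root_.map_add, hP, hQ, mul_add]
  | hm i b => rw [OrePoly.smul_mono, OrePoly.liftAux_mono, OrePoly.liftAux_mono,
      _root_.map_mul, mul_assoc]

variable (δ) in
/-- The universal property of the ring of Ore polynomials. -/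
noncomputable def OrePoly.lift (hξ : ∀ b, ξ * f b = f (θ b) * ξ + f (δ b)) : OrePoly δ →+* S where
  toFun := OrePoly.liftAux f ξ
  map_zero' := _root_.map_zero _
  map_add' := _root_.map_add _
  map_one' := by
    change OrePoly.liftAux f ξ (OrePoly.mono δ 0 1) = 1
    rw [OrePoly.liftAux_mono, pow_zero, mul_one, _root_.map_one]
  map_mul' P Q := by
    have hX (Q : OrePoly δ) : OrePoly.liftAux f ξ (OrePoly.mulX δ Q) =
        ξ * OrePoly.liftAux f ξ Q := by
      induction Q using OrePoly.induction with
      | hadd P Q hP hQ => simp only [_root_.map_add, hP, hQ, mul_add]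
      | hm i b =>
        rw [OrePoly.mulX_mono, _root_.map_add, OrePoly.liftAux_mono, OrePoly.liftAux_mono,
          OrePoly.liftAux_mono, ← mul_assoc ξ, hξ, add_mul, pow_succ', mul_assoc (f (θ b))]
    induction P using OrePoly.induction with
    | hadd P P' h h' => simp only [add_mul, _root_.map_add, h, h']
    | hm i a =>
      rw [OrePoly.mono_mul, OrePoly.liftAux_smul, OrePoly.liftAux_mono, mul_assoc]
      congr 1
      induction i with
      | zero => rw [pow_zero, one_mul]; rfl
      | succ i ih => rw [Function.iterate_succ_apply', hX, ih, pow_succ', mul_assoc]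

variable (hξ : ∀ b, ξ * f b = f (θ b) * ξ + f (δ b))

theorem OrePoly.lift_C (a : K) : OrePoly.lift δ f ξ hξ (OrePoly.C δ a) = f a :=
  (OrePoly.liftAux_mono f ξ 0 a).trans (by rw [pow_zero, mul_one])

theorem OrePoly.lift_X : OrePoly.lift δ f ξ hξ (OrePoly.X δ) = ξ :=
  (OrePoly.liftAux_mono f ξ 1 1).trans (by rw [pow_one, _root_.map_one, one_mul])

end Lift

end OreBasics

/-! ### Evaluation at one unramified point: root count, surjectivity, kernel and centrality of Z(X).
-/

section Evaluation

variable {K : Type*} [Field K] {θ : K →+* K} {δ : SkewDerivation θ}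

theorem pseudoLinear_apply (c x : K) : pseudoLinear δ c x = δ x + c * θ x := rfl

theorem pseudoLinear_one (c : K) : pseudoLinear δ c 1 = c := by
  rw [pseudoLinear_apply, δ.map_one, _root_.map_one, zero_add, mul_one]

theorem mem_constField {b : K} : b ∈ constField δ ↔ θ b = b ∧ δ b = 0 := Iff.rfl

/-- At an unramified point, the scalars commuting with `δ + c θ` at one nonzero vector are
constants. -/
theorem mem_constField_of_pseudoLinear_mul {c : K} (hc : ¬ IsRamified δ c) {x b : K} (hx : x ≠ 0)
    (h : pseudoLinear δ c (b * x) = b * pseudoLinear δ c x) : b ∈ constField δ := by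
  rw [pseudoLinear_smul] at h
  by_cases hθ : θ = RingHom.id K
  · have hb : θ b = b := by rw [hθ]; rfl
    rw [hb, add_eq_left] at h
    exact mem_constField.mpr ⟨hb, (mul_eq_zero.mp h).resolve_right hx⟩
  · have hb : θ b = b := by
      have h1 := twist_spec δ hθ
      rw [pseudoLinear_apply, h1 b, h1 x] at h
      have h2 : (θ b - b) * ((twist δ hθ + c) * θ x) = 0 := by linear_combination h
      refine sub_eq_zero.mp ((mul_eq_zero.mp h2).resolve_right
        (mul_ne_zero (fun h0 => hc ⟨-twist δ hθ, fun y => ?_⟩) ((map_ne_zero θ).mpr hx)))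
      rw [h1 y]; linear_combination (θ y) * h0
    refine mem_constField.mpr ⟨hb, ?_⟩
    rw [twist_spec δ hθ, hb, sub_self, mul_zero]

/-- `ev_c` as a `K`-linear map. -/
noncomputable def evalLin (δ : SkewDerivation θ) (c : K) :
    OrePoly δ →ₗ[K] (K →ₗ[constField δ] K) where
  toFun := evalAt δ c
  map_add' := _root_.map_add _
  map_smul' := evalAt_smul δ c

/-- The map g sends the kernel of f ∘ g into that of f, and its restriction has kernel inside that
of g. -/
theorem finrank_ker_comp_le {F V : Type*} [Field F] [AddCommGroup V] [Module F V]
    [FiniteDimensional F V] (f g : V →ₗ[F] V) :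
    Module.finrank F (LinearMap.ker (f ∘ₗ g)) ≤
      Module.finrank F (LinearMap.ker f) + Module.finrank F (LinearMap.ker g) := by
  have h := LinearMap.finrank_range_add_finrank_ker (g.domRestrict (LinearMap.ker (f ∘ₗ g)))
  rw [← h]
  refine add_le_add (Submodule.finrank_mono ?_) ?_
  · rintro _ ⟨⟨x, hx⟩, rfl⟩
    exact hx
  · rw [← Submodule.finrank_map_subtype_eq]
    refine Submodule.finrank_mono ?_
    rintro _ ⟨⟨x, hx⟩, hx', rfl⟩
    exact hx'

theorem C_commute (a : constField δ) (P : OrePoly δ) : Commute (OrePoly.C δ (a : K)) P := by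
  refine OrePoly.commute_of_commute_gen (fun b => ?_) ?_ P
  · rw [← _root_.map_mul, ← _root_.map_mul, mul_comm]
  · rw [OrePoly.X_mul_C, a.2.1, a.2.2, _root_.map_zero, add_zero]

theorem evalAt_C_eq (c a : K) : evalAt δ c (OrePoly.C δ a) = a • (1 : Module.End _ K) := by
  ext x; exact evalAt_C δ c a x

variable [FiniteDimensional (constField δ) K]

/-- A nonzero Ore polynomial of degree `n`, evaluated at an unramified point, has a kernel of
dimension at most `n`. -/
theorem finrank_ker_evalAt_le {c : K} (hc : ¬ IsRamified δ c) (f : OrePoly δ) (hf : f ≠ 0) :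
    Module.finrank (constField δ) (LinearMap.ker (evalAt δ c f)) ≤ f.natDegree := by
  induction hn : f.natDegree generalizing f with
  | zero =>
    obtain ⟨a, rfl⟩ : ∃ a, f = OrePoly.C δ a :=
      ⟨_, Polynomial.eq_C_of_natDegree_eq_zero (p := OrePoly.toPoly δ f) hn⟩
    have ha : a ≠ 0 := fun h => hf (by rw [h, _root_.map_zero])
    have : LinearMap.ker (evalAt δ c (OrePoly.C δ a)) = ⊥ := by
      refine (Submodule.eq_bot_iff _).mpr fun x hx => ?_
      rw [LinearMap.mem_ker, evalAt_C] at hx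
      exact (mul_eq_zero.mp hx).resolve_left ha
    rw [this, finrank_bot]
  | succ n ih =>
    by_cases hker : LinearMap.ker (evalAt δ c f) = ⊥
    · rw [hker, finrank_bot]; exact Nat.zero_le _
    obtain ⟨x, hxk, hx⟩ := (Submodule.ne_bot_iff _).mp hker
    rw [LinearMap.mem_ker] at hxk
    -- This u makes X - u vanish at x under ev_c, so the remainder r of f modulo X - u satisfies r x
    -- = 0.
    set u := pseudoLinear δ c x / x with hu
    obtain ⟨r, q, hq⟩ := exists_remainder δ u f
    have hlin (y : K) : evalAt δ c (OrePoly.X δ - OrePoly.C δ u) y =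
        pseudoLinear δ c y - u * y := by
      rw [_root_.map_sub, evalAt_X, LinearMap.sub_apply, evalAt_C]
    have hux : u * x = pseudoLinear δ c x := div_mul_cancel₀ _ hx
    have hr : r = 0 := by
      rw [hq, _root_.map_add, _root_.map_mul, LinearMap.add_apply, Module.End.mul_apply, hlin,
        hux, sub_self, _root_.map_zero, zero_add, evalAt_C] at hxk
      exact (mul_eq_zero.mp hxk).resolve_right hx
    rw [hr, _root_.map_zero, add_zero] at hq
    have hXu : (OrePoly.X δ - OrePoly.C δ u).natDegree = 1 := by
      rw [sub_eq_add_neg, ← _root_.map_neg]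
      exact OrePoly.natDegree_X_add_C _
    have hdeg := OrePoly.natDegree_mul (left_ne_zero_of_mul (hq ▸ hf))
      (right_ne_zero_of_mul (hq ▸ hf))
    rw [← hq, hXu, hn, add_left_inj] at hdeg
    have h1 : Module.finrank (constField δ)
        (LinearMap.ker (evalAt δ c (OrePoly.X δ - OrePoly.C δ u))) ≤ 1 := by
      -- The kernel of X - u is the line F x: if y lies in it, then multiplication by y / x commutes
      -- with δ + cθ at x, so y / x is a constant.
      rw [← finrank_span_singleton (K := constField δ) hx]
      refine Submodule.finrank_mono fun y hy => ?_
      rw [LinearMap.mem_ker, hlin, sub_eq_zero] at hy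
      have hb := mem_constField_of_pseudoLinear_mul hc (b := y / x) hx (by
        rw [div_mul_cancel₀ _ hx, hy, hu]; ring)
      exact Submodule.mem_span_singleton.mpr ⟨⟨y / x, hb⟩, div_mul_cancel₀ _ hx⟩
    have h2 := finrank_ker_comp_le (evalAt δ c q) (evalAt δ c (OrePoly.X δ - OrePoly.C δ u))
    have h3 := ih q (left_ne_zero_of_mul (hq ▸ hf)) hdeg.symm
    rw [hq, _root_.map_mul]
    exact h2.trans (add_le_add h3 h1)

theorem finrank_end : Module.finrank K (K →ₗ[constField δ] K) = Module.finrank (constField δ) K :=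
  Module.finrank_linearMap_self (constField δ) K K

/-- Evaluation at an unramified point is surjective. -/
theorem evalAt_surjective {c : K} (hc : ¬ IsRamified δ c) :
    Function.Surjective (evalAt δ c) := by
  set s := Module.finrank (constField δ) K with hs
  have := (OrePoly.finrank_degreeLT (δ := δ) s).1
  let e : OrePoly.degreeLT δ s →ₗ[K] (K →ₗ[constField δ] K) :=
    (evalLin δ c).domRestrict (OrePoly.degreeLT δ s)
  have hinj : Function.Injective e := by
    rw [← LinearMap.ker_eq_bot, Submodule.eq_bot_iff]
    rintro ⟨f, hf⟩ h0
    by_contra hne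
    have hf0 : f ≠ 0 := fun h => hne (Subtype.ext h)
    have h1 : evalAt δ c f = 0 := h0
    have h2 := finrank_ker_evalAt_le hc f hf0
    rw [h1, LinearMap.ker_zero, finrank_top] at h2
    rw [OrePoly.mem_degreeLT_iff hf0] at hf
    omega
  -- Both spaces have dimension [K:F] over K, and injectivity is the root count applied to f with
  -- ev_c(f) = 0.
  have hsurj := (LinearMap.injective_iff_surjective_of_finrank_eq_finrank
    ((OrePoly.finrank_degreeLT s).2.trans finrank_end.symm)).mp hinj
  intro φ
  obtain ⟨f, hf⟩ := hsurj φ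
  exact ⟨f.1, hf⟩

theorem minAnnihilator_spec (δ : SkewDerivation θ) [FiniteDimensional (constField δ) K] :
    (minAnnihilator δ).Monic ∧ evalAt δ 0 (minAnnihilator δ) = 0 ∧
      ∀ Q : OrePoly δ, Q ≠ 0 → evalAt δ 0 Q = 0 →
        (minAnnihilator δ).natDegree ≤ Q.natDegree := by
  obtain ⟨h1, h2, h3⟩ := Classical.choose_spec (exists_annihilator δ)
  refine ⟨h1, h2, fun Q hQ h => ?_⟩
  obtain ⟨a, -, hm, hd⟩ := OrePoly.smul_monic hQ
  rw [← hd]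
  exact h3 _ hm (by rw [evalAt_smul, h, smul_zero])

/-- Being F-linear and injective on a finite-dimensional space, θ is an F-automorphism of K, and
there are at most [K:F] of these. -/
theorem orderOf_pos_and_le (δ : SkewDerivation θ) [FiniteDimensional (constField δ) K] :
    0 < orderOf θ ∧ orderOf θ ≤ Module.finrank (constField δ) K := by
  let φ : K →ₐ[constField δ] K := { θ with commutes' := fun a => a.2.1 }
  have hφ : Function.Injective φ.toLinearMap := θ.injective
  let e : K ≃ₐ[constField δ] K :=
    AlgEquiv.ofBijective φ ⟨hφ, LinearMap.injective_iff_surjective.mp hφ⟩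
  let ι : (K ≃ₐ[constField δ] K) →* (K →+* K) :=
    { toFun := fun e => e.toRingEquiv.toRingHom
      map_one' := rfl
      map_mul' := fun _ _ => rfl }
  have hι : Function.Injective ι := fun e e' h => AlgEquiv.ext fun x => RingHom.congr_fun h x
  have he : ι e = θ := RingHom.ext fun x => rfl
  have h := orderOf_injective ι hι e
  rw [he] at h
  rw [h]
  exact ⟨orderOf_pos e, orderOf_le_card.trans (by
    rw [Nat.card_eq_fintype_card]; exact AlgEquiv.card_le)⟩

/-- The point 0 may be ramified, so the root count is not available here. Minimality replaces it:
ev_0 is injective below the degree of the annihilator, and End_F(K) has K-dimension [K:F]. -/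
theorem natDegree_minAnnihilator (δ : SkewDerivation θ) [FiniteDimensional (constField δ) K] :
    0 < (minAnnihilator δ).natDegree ∧
      (minAnnihilator δ).natDegree ≤ Module.finrank (constField δ) K := by
  obtain ⟨h1, h2, h3⟩ := minAnnihilator_spec δ
  constructor
  · rw [Nat.pos_iff_ne_zero]
    intro h0
    have h4 : minAnnihilator δ = 1 := Polynomial.Monic.natDegree_eq_zero h1 |>.mp h0
    rw [h4, _root_.map_one] at h2
    exact one_ne_zero h2
  · rw [← finrank_end, ← (OrePoly.finrank_degreeLT (δ := δ) (minAnnihilator δ).natDegree).2]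
    refine LinearMap.finrank_le_finrank_of_injective
      (f := (evalLin δ 0).domRestrict (OrePoly.degreeLT δ (minAnnihilator δ).natDegree)) ?_
    rw [← LinearMap.ker_eq_bot, Submodule.eq_bot_iff]
    rintro ⟨f, hf⟩ h0
    by_contra hne
    have hf0 : f ≠ 0 := fun h => hne (Subtype.ext h)
    rw [OrePoly.mem_degreeLT_iff hf0] at hf
    exact absurd (h3 f hf0 h0) (not_le.mpr hf)

theorem natDegree_centralZ (δ : SkewDerivation θ) [FiniteDimensional (constField δ) K] :
    0 < (centralZ δ).natDegree ∧
      (centralZ δ).natDegree ≤ Module.finrank (constField δ) K := by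
  unfold centralZ
  split_ifs with h
  · exact natDegree_minAnnihilator δ
  · rw [OrePoly.natDegree_pow (OrePoly.X_add_C_ne_zero _), OrePoly.natDegree_X_add_C, mul_one]
    exact orderOf_pos_and_le δ

/-- The commutator of Z and X is killed by ev_0. Since θ = id and δ 1 = 0, its top coefficients
cancel and its degree drops below that of Z, so minimality forces it to vanish. -/
theorem minAnnihilator_mul_X (h : θ = RingHom.id K) :
    minAnnihilator δ * OrePoly.X δ = OrePoly.X δ * minAnnihilator δ := by
  obtain ⟨h1, h2, h3⟩ := minAnnihilator_spec δ
  have hpos := (natDegree_minAnnihilator δ).1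
  set Z := minAnnihilator δ
  by_contra hne
  have hW0 := sub_ne_zero.mpr hne
  refine absurd (h3 _ hW0 (by
    rw [_root_.map_sub, _root_.map_mul, _root_.map_mul, h2, zero_mul, mul_zero, sub_zero]))
    (not_le.mpr (OrePoly.natDegree_lt_of_coeff hW0 fun n hn => ?_))
  obtain ⟨n, rfl⟩ : ∃ n', n = n' + 1 := ⟨n - 1, by omega⟩
  have hδ : δ (Z.coeff (n + 1)) = 0 := by
    rcases hn.eq_or_lt with h0 | h0
    · rw [← h0, show Z.coeff Z.natDegree = 1 from h1, δ.map_one]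
    · rw [Z.coeff_eq_zero_of_natDegree_lt _ h0, δ.map_zero]
  rw [OrePoly.coeff_sub, OrePoly.coeff_mul_X_succ, OrePoly.X_mul, OrePoly.coeff_mulX_succ, hδ,
    add_zero, RingHom.congr_fun h, RingHom.id_apply, sub_self]

/-- When θ ≠ id, a power of X + a commutes with X + a, and this one also with the constant a, hence
with X. -/
theorem centralZ_commute (P : OrePoly δ) : Commute (centralZ δ) P := by
  refine OrePoly.commute_of_commute_gen (centralZ_comm δ) ?_ P
  by_cases h : θ = RingHom.id K
  · rw [centralZ, dif_pos h]; exact minAnnihilator_mul_X h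
  · have h1 : Commute (centralZ δ) (OrePoly.X δ + OrePoly.C δ (twist δ h)) := by
      rw [centralZ, dif_neg h]; exact (Commute.refl _).pow_left _
    have h2 : Commute (centralZ δ) (OrePoly.C δ (twist δ h)) := centralZ_comm δ _
    have h3 := h1.sub_right h2
    rwa [add_sub_cancel_right] at h3

/-- The embedding `F[x] → K[X; θ, δ]`, `x ↦ Z(X)`. -/
noncomputable def centralHom (δ : SkewDerivation θ) [FiniteDimensional (constField δ) K] :
    (constField δ)[X] →+* OrePoly δ :=
  Polynomial.eval₂RingHom' ((OrePoly.C δ).comp (constField δ).subtype) (centralZ δ)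
    fun _ => (centralZ_commute _).symm

theorem centralHom_C (a : constField δ) : centralHom δ (Polynomial.C a) = OrePoly.C δ (a : K) :=
  Polynomial.eval₂_C _ _

theorem centralHom_X : centralHom δ Polynomial.X = centralZ δ := Polynomial.eval₂_X _ _

theorem centralHom_commute (p : (constField δ)[X]) (P : OrePoly δ) :
    Commute (centralHom δ p) P := by
  induction p using Polynomial.induction_on' with
  | add p q hp hq => rw [_root_.map_add]; exact hp.add_left hq
  | monomial n a =>
    rw [← Polynomial.C_mul_X_pow_eq_monomial, _root_.map_mul, _root_.map_pow, centralHom_C,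
      centralHom_X]
    exact (C_commute a P).mul_left ((centralZ_commute P).pow_left n)

theorem evalAt_centralZ (c : K) :
    evalAt δ c (centralZ δ) = upsilon δ c • (1 : Module.End _ K) := by
  have h := evalAt_modulus δ c
  rwa [modulus, _root_.map_sub, sub_eq_zero, evalAt_C_eq] at h

/-- Since Z is central, the scalar ev_c(Z) commutes with δ + cθ. -/
theorem upsilon_mem {c : K} (hc : ¬ IsRamified δ c) : upsilon δ c ∈ constField δ := by
  refine mem_constField_of_pseudoLinear_mul hc one_ne_zero ?_
  have h := congrArg (evalAt δ c) (centralZ_commute (OrePoly.X δ)).eq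
  rw [_root_.map_mul, _root_.map_mul, evalAt_X, evalAt_centralZ] at h
  exact (LinearMap.congr_fun h 1).symm

/-- `υ(c)` as an element of `F`. -/
noncomputable def ups {c : K} (hc : ¬ IsRamified δ c) : constField δ :=
  ⟨upsilon δ c, upsilon_mem hc⟩

theorem modulus_eq {c : K} (hc : ¬ IsRamified δ c) :
    modulus δ c = centralHom δ (Polynomial.X - Polynomial.C (ups hc)) := by
  rw [_root_.map_sub, centralHom_C, centralHom_X]; rfl

theorem modulus_commute {c : K} (hc : ¬ IsRamified δ c) (P : OrePoly δ) :
    Commute (modulus δ c) P := by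
  rw [modulus_eq hc]; exact centralHom_commute _ P

theorem evalAt_centralHom {c : K} (hc : ¬ IsRamified δ c) (p : (constField δ)[X]) :
    evalAt δ c (centralHom δ p) = p.eval (ups hc) • (1 : Module.End _ K) := by
  have : (evalAt δ c).comp (centralHom δ) =
      (algebraMap (constField δ) (Module.End (constField δ) K)).comp
        (Polynomial.evalRingHom (ups hc)) := by
    refine Polynomial.ringHom_ext (fun a => ?_) ?_
    · rw [RingHom.comp_apply, centralHom_C, evalAt_C_eq, RingHom.comp_apply,
        Polynomial.coe_evalRingHom, Polynomial.eval_C]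
      rfl
    · rw [RingHom.comp_apply, centralHom_X, evalAt_centralZ, RingHom.comp_apply,
        Polynomial.coe_evalRingHom, Polynomial.eval_X]
      rfl
  exact RingHom.congr_fun this p

theorem modulus_ne_zero (c : K) : modulus δ c ≠ 0 := by
  intro h
  have h1 := (natDegree_centralZ δ).1
  rw [sub_eq_zero.mp h, OrePoly.natDegree_C] at h1
  exact lt_irrefl 0 h1

/-- The lower bound is the root count: ev_c kills the modulus, so its kernel is all of K. -/
theorem natDegree_modulus {c : K} (hc : ¬ IsRamified δ c) :
    (modulus δ c).natDegree = Module.finrank (constField δ) K := by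
  refine le_antisymm ?_ ?_
  · rw [← Nat.lt_succ_iff]
    refine (OrePoly.mem_degreeLT_iff (modulus_ne_zero c)).mp (Submodule.sub_mem _ ?_
      (OrePoly.C_mem_degreeLT _ (Nat.succ_pos _)))
    refine OrePoly.mem_degreeLT.mpr fun m hm => OrePoly.coeff_eq_zero_of_natDegree_lt _ _ ?_
    have := (natDegree_centralZ δ).2
    omega
  · have h := finrank_ker_evalAt_le hc _ (modulus_ne_zero c)
    rwa [evalAt_modulus, LinearMap.ker_zero, finrank_top] at h

/-- The kernel of `ev_c` is generated by the modulus. -/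
theorem exists_eq_mul_modulus {c : K} (hc : ¬ IsRamified δ c) {f : OrePoly δ}
    (hf : evalAt δ c f = 0) : ∃ g, f = g * modulus δ c := by
  obtain ⟨q, r, hqr, hr⟩ := OrePoly.exists_div _ (modulus_ne_zero c) f
  have h1 : evalAt δ c r = 0 := by
    rw [hqr, _root_.map_add, _root_.map_mul, evalAt_modulus, mul_zero, zero_add] at hf
    exact hf
  by_cases hr0 : r = 0
  · exact ⟨q, by rw [hqr, hr0, add_zero]⟩
  · have h2 := finrank_ker_evalAt_le hc r hr0
    rw [h1, LinearMap.ker_zero, finrank_top] at h2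
    rw [OrePoly.mem_degreeLT_iff hr0, natDegree_modulus hc] at hr
    omega

end Evaluation

/-! ### Simultaneous evaluation at points with distinct z_i. -/

section ManyPoints

variable {K : Type*} [Field K] {θ : K →+* K} {δ : SkewDerivation θ} {m : ℕ} {c : Fin m → K}

/-- The `K`-linear map sending `f` to the restrictions of the `ev_{cᵢ}(f)` to `Uᵢ`. -/
noncomputable def restrictEval (c : Fin m → K) (U : Fin m → Submodule (constField δ) K) :
    OrePoly δ →ₗ[K] (∀ i, U i →ₗ[constField δ] K) where
  toFun f i := (evalAt δ (c i) f).domRestrict (U i)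
  map_add' f g := by
    funext i; rw [_root_.map_add]; rfl
  map_smul' a f := by
    funext i; rw [evalAt_smul]; rfl

theorem restrictEval_eq_zero {U : Fin m → Submodule (constField δ) K} {f : OrePoly δ} :
    restrictEval c U f = 0 ↔ ∀ i, U i ≤ LinearMap.ker (evalAt δ (c i) f) := by
  constructor
  · intro h i x hx
    exact LinearMap.congr_fun (congrFun h i) ⟨x, hx⟩
  · intro h
    funext i
    ext x
    exact h i x.2

variable [FiniteDimensional (constField δ) K]

theorem finite_linearMap {F K U : Type*} [Field F] [Field K] [Algebra F K] [AddCommGroup U]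
    [Module F U] [FiniteDimensional F U] : Module.Finite K (U →ₗ[F] K) :=
  Module.Finite.equiv ((Module.finBasis F U).constr K)

theorem finite_restrictions (U : Fin m → Submodule (constField δ) K) :
    Module.Finite K (∀ i, U i →ₗ[constField δ] K) :=
  have (i : Fin m) : Module.Finite K (U i →ₗ[constField δ] K) := finite_linearMap
  Module.Finite.pi

theorem ups_injective (hc : ∀ i, ¬ IsRamified δ (c i))
    (hυ : Function.Injective fun i => upsilon δ (c i)) :
    Function.Injective fun i => ups (hc i) :=
  fun _ _ h => hυ (congrArg Subtype.val h)

/-- The Chinese remainder theorem for the evaluations at `c₁, …, cₘ`. -/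
theorem exists_evalAt_eq (hc : ∀ i, ¬ IsRamified δ (c i))
    (hυ : Function.Injective fun i => upsilon δ (c i))
    (φ : Fin m → Module.End (constField δ) K) : ∃ f : OrePoly δ, ∀ i, evalAt δ (c i) f = φ i := by
  classical
  choose g hg using fun i => evalAt_surjective (hc i) (φ i)
  -- The Lagrange basis polynomials in Z are central and evaluate to 0 or 1 at the points, so they
  -- act as idempotents that glue the local solutions.
  refine ⟨∑ j, centralHom δ (Lagrange.basis Finset.univ (fun i => ups (hc i)) j) * g j,
    fun i => ?_⟩
  rw [_root_.map_sum, Finset.sum_eq_single i]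
  · rw [_root_.map_mul, evalAt_centralHom (hc i), Lagrange.eval_basis_self
      (ups_injective hc hυ).injOn (Finset.mem_univ i), one_smul, one_mul, hg]
  · intro j _ hj
    rw [_root_.map_mul, evalAt_centralHom (hc i),
      Lagrange.eval_basis_of_ne (v := fun i => ups (hc i)) hj (Finset.mem_univ i),
      zero_smul, zero_mul]
  · exact fun h => absurd (Finset.mem_univ i) h

theorem finrank_restrictions (U : Fin m → Submodule (constField δ) K) :
    Module.finrank K (∀ i, U i →ₗ[constField δ] K) =
      ∑ i, Module.finrank (constField δ) (U i) := by
  have (i : Fin m) : Module.Finite K (U i →ₗ[constField δ] K) := finite_linearMap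
  rw [Module.finrank_pi_fintype]
  exact Finset.sum_congr rfl fun i _ => Module.finrank_linearMap_self (constField δ) K (U i)

theorem restrictEval_surjective (hc : ∀ i, ¬ IsRamified δ (c i))
    (hυ : Function.Injective fun i => upsilon δ (c i))
    (U : Fin m → Submodule (constField δ) K) : Function.Surjective (restrictEval c U) := by
  intro φ
  choose ψ hψ using fun i => (φ i).exists_extend
  obtain ⟨f, hf⟩ := exists_evalAt_eq hc hυ ψ
  exact ⟨f, funext fun i => (congrArg (fun g => LinearMap.domRestrict g (U i)) (hf i)).trans (hψ i)⟩

/-- Left multiples of f vanish on the U_i, so a preimage may be replaced by its remainder modulo f.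
-/
theorem restrictEval_degreeLT_surjective (hc : ∀ i, ¬ IsRamified δ (c i))
    (hυ : Function.Injective fun i => upsilon δ (c i))
    {U : Fin m → Submodule (constField δ) K} {f : OrePoly δ} (hf : f ≠ 0)
    (hU : ∀ i, U i ≤ LinearMap.ker (evalAt δ (c i) f)) :
    Function.Surjective ((restrictEval c U).domRestrict (OrePoly.degreeLT δ f.natDegree)) := by
  intro φ
  obtain ⟨h, rfl⟩ := restrictEval_surjective hc hυ U φ
  obtain ⟨q, r, hqr, hr⟩ := OrePoly.exists_div f hf h
  refine ⟨⟨r, hr⟩, ?_⟩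
  have h0 : restrictEval c U (q * f) = 0 := restrictEval_eq_zero.mpr fun i x hx => by
    rw [LinearMap.mem_ker, _root_.map_mul, Module.End.mul_apply, hU i hx, _root_.map_zero]
  rw [hqr, _root_.map_add, h0, zero_add]; rfl

/-- The kernels of the evaluations of `f` at several points have total dimension at most
`deg f`. -/
theorem sum_finrank_le_natDegree (hc : ∀ i, ¬ IsRamified δ (c i))
    (hυ : Function.Injective fun i => upsilon δ (c i))
    {U : Fin m → Submodule (constField δ) K} {f : OrePoly δ} (hf : f ≠ 0)
    (hU : ∀ i, U i ≤ LinearMap.ker (evalAt δ (c i) f)) :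
    ∑ i, Module.finrank (constField δ) (U i) ≤ f.natDegree := by
  have := (OrePoly.finrank_degreeLT (δ := δ) f.natDegree).1
  rw [← finrank_restrictions, ← (OrePoly.finrank_degreeLT (δ := δ) f.natDegree).2]
  exact LinearMap.finrank_le_finrank_of_surjective
    (restrictEval_degreeLT_surjective hc hυ hf hU)

/-- In the equality case of the root count, restriction is bijective on degrees below deg f. The
remainder of h modulo f restricts to zero, hence is zero. -/
theorem exists_eq_mul_of_vanish (hc : ∀ i, ¬ IsRamified δ (c i))
    (hυ : Function.Injective fun i => upsilon δ (c i))
    {U : Fin m → Submodule (constField δ) K} {f : OrePoly δ} (hf : f ≠ 0)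
    (hU : ∀ i, U i ≤ LinearMap.ker (evalAt δ (c i) f))
    (hdeg : f.natDegree ≤ ∑ i, Module.finrank (constField δ) (U i)) {h : OrePoly δ}
    (hh : ∀ i, U i ≤ LinearMap.ker (evalAt δ (c i) h)) : ∃ q, h = q * f := by
  have := (OrePoly.finrank_degreeLT (δ := δ) f.natDegree).1
  have := finite_restrictions U
  have hinj := (LinearMap.injective_iff_surjective_of_finrank_eq_finrank (by
    
    rw [(OrePoly.finrank_degreeLT _).2, finrank_restrictions]
    exact le_antisymm hdeg (sum_finrank_le_natDegree hc hυ hf hU))).mpr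
      (restrictEval_degreeLT_surjective hc hυ hf hU)
  obtain ⟨q, r, hqr, hr⟩ := OrePoly.exists_div f hf h
  have hr0 : restrictEval c U r = 0 := restrictEval_eq_zero.mpr fun i x hx => by
    have h1 := hh i hx
    rw [LinearMap.mem_ker, hqr, _root_.map_add, _root_.map_mul, LinearMap.add_apply,
      Module.End.mul_apply, hU i hx, _root_.map_zero, zero_add] at h1
    exact h1
  have h2 := @hinj ⟨r, hr⟩ 0 (by rw [_root_.map_zero]; exact hr0)
  have h3 : r = 0 := congrArg Subtype.val h2
  exact ⟨q, by rw [hqr, h3, add_zero]⟩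

end ManyPoints

/-! ### Compositional inversion of a polynomial with a simple zero at 0. -/

section PowerSeriesRoot

variable {F : Type*} [Field F]

/-- A polynomial with a simple root at `0` takes the value `T` at some power series in `T` without
constant coefficient. -/
theorem exists_powerSeries_root (h : F[X]) (h0 : h.coeff 0 = 0) (h1 : h.coeff 1 ≠ 0) :
    ∃ τ : PowerSeries F, PowerSeries.constantCoeff τ = 0 ∧
      h.eval₂ PowerSeries.C τ = PowerSeries.X := by
  set w := h.coeff 1 with hw
  -- With w the linear coefficient, h(τ) = w τ + τ q(τ), and q(τ) is divisible by τ.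
  let q : PowerSeries F → PowerSeries F := fun τ => (h.divX.divX * X).eval₂ PowerSeries.C τ
  have hq (τ : PowerSeries F) : h.eval₂ PowerSeries.C τ = τ * q τ + PowerSeries.C w * τ := by
    conv_lhs => rw [← h.divX_mul_X_add, ← h.divX.divX_mul_X_add]
    rw [coeff_divX, h0, zero_add, ← hw]
    simp only [q, eval₂_add, eval₂_mul, eval₂_X, eval₂_C, _root_.map_zero, eval₂_zero]
    ring
  have hqX (τ : PowerSeries F) : τ ∣ q τ := by
    simp only [q, eval₂_mul, eval₂_X]
    exact dvd_mul_left _ _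
  have hqsub (τ σ : PowerSeries F) : τ - σ ∣ q τ - q σ := by
    simp only [q, ← eval_map]
    exact sub_dvd_eval_sub _ _ _
  -- The equation h(τ) = T is equivalent to G τ = τ. On series without constant term G is T-adically
  -- contracting, by `hGsub`, so its iterates from 0 converge to the root.
  let G : PowerSeries F → PowerSeries F := fun τ =>
    PowerSeries.C w⁻¹ * (PowerSeries.X - τ * q τ)
  have hGX {τ : PowerSeries F} (hτ : PowerSeries.X ∣ τ) : PowerSeries.X ∣ G τ :=
    Dvd.dvd.mul_left (dvd_sub dvd_rfl (hτ.mul_right _)) _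
  have hGsub {τ σ : PowerSeries F} {n : ℕ} (hτ : PowerSeries.X ∣ τ) (hσ : PowerSeries.X ∣ σ)
      (hn : PowerSeries.X ^ n ∣ τ - σ) : PowerSeries.X ^ (n + 1) ∣ G τ - G σ := by
    have : G τ - G σ = PowerSeries.C w⁻¹ * -((τ - σ) * q τ + (q τ - q σ) * σ) := by
      simp only [G]; ring
    rw [this, pow_succ]
    refine Dvd.dvd.mul_left ((dvd_neg).mpr (dvd_add ?_ ?_)) _
    · exact mul_dvd_mul hn (hτ.trans (hqX τ))
    · exact mul_dvd_mul (hn.trans (hqsub τ σ)) hσ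
  let a : ℕ → PowerSeries F := fun n => G^[n] 0
  have haX (n : ℕ) : PowerSeries.X ∣ a n := by
    induction n with
    | zero => exact dvd_zero _
    | succ n ih => simp only [a, Function.iterate_succ_apply']; exact hGX ih
  have hstep (n : ℕ) : PowerSeries.X ^ (n + 1) ∣ a (n + 1) - a n := by
    induction n with
    | zero => rw [zero_add, pow_one]; exact dvd_sub (haX _) (haX _)
    | succ n ih =>
      have := hGsub (haX _) (haX _) ih
      simpa only [a, ← Function.iterate_succ_apply' G] using this
  have hcoeff (m n : ℕ) (hmn : m ≤ n) :
      PowerSeries.coeff m (a (n + 1)) = PowerSeries.coeff m (a (m + 1)) := by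
    induction n, hmn using Nat.le_induction with
    | base => rfl
    | succ n hn ih =>
      rw [← ih, ← sub_eq_zero, ← _root_.map_sub]
      exact PowerSeries.X_pow_dvd_iff.mp (hstep (n + 1)) m (by omega)
  -- By `hcoeff` the coefficient of index n no longer changes from the iterate of index n + 1 on, so
  -- τ is the limit.
  let τ : PowerSeries F := PowerSeries.mk fun n => PowerSeries.coeff n (a (n + 1))
  have hτ (n : ℕ) : PowerSeries.X ^ (n + 1) ∣ τ - a (n + 1) := by
    rw [PowerSeries.X_pow_dvd_iff]
    intro m hm
    rw [_root_.map_sub, PowerSeries.coeff_mk, hcoeff m n (by omega), sub_self]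
  have hτX : PowerSeries.X ∣ τ := by
    have h2 := hτ 0
    rw [zero_add, pow_one] at h2
    have h3 := dvd_add h2 (haX 1)
    rwa [sub_add_cancel] at h3
  have hfix : G τ = τ := by
    ext n
    have h2 := hGsub hτX (haX _) (hτ n)
    have h3 := hτ (n + 1)
    rw [← sub_eq_zero, ← _root_.map_sub]
    have h4 : G (a (n + 1)) = a (n + 1 + 1) := (Function.iterate_succ_apply' G (n + 1) 0).symm
    rw [h4] at h2
    have h5 := dvd_sub h2 h3
    rw [sub_sub_sub_cancel_right] at h5
    exact PowerSeries.X_pow_dvd_iff.mp h5 n (by omega)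
  refine ⟨τ, PowerSeries.X_dvd_iff.mp hτX, ?_⟩
  have h2 : PowerSeries.C w * G τ = PowerSeries.X - τ * q τ := by
    simp only [G]
    rw [← mul_assoc, ← _root_.map_mul, mul_inv_cancel₀ h1, _root_.map_one, one_mul]
  rw [hfix] at h2
  rw [hq, h2]
  ring

end PowerSeriesRoot

/-! ### Deforming ev_c, and Taylor expansion with values in End_F(K)[[T]]. -/

section Deformation

variable {K : Type*} [Field K] {θ : K →+* K} {δ : SkewDerivation θ}

/-- The `F`-linear endomorphism `g θ` of `K`. -/
noncomputable def scaledTheta (δ : SkewDerivation θ) (g : K) : Module.End (constField δ) K :=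
  pseudoLinear δ g - pseudoLinear δ 0

theorem scaledTheta_apply (g x : K) : scaledTheta δ g x = g * θ x := by
  rw [scaledTheta, LinearMap.sub_apply, pseudoLinear_apply, pseudoLinear_apply]; ring

theorem pseudoLinear_mul_C (c b : K) :
    pseudoLinear δ c * evalAt δ c (OrePoly.C δ b) =
      evalAt δ c (OrePoly.C δ (θ b)) * pseudoLinear δ c + evalAt δ c (OrePoly.C δ (δ b)) := by
  rw [← evalAt_X, ← _root_.map_mul, OrePoly.X_mul_C, _root_.map_add, _root_.map_mul]

theorem scaledTheta_mul_C (c g b : K) :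
    scaledTheta δ g * evalAt δ c (OrePoly.C δ b) =
      evalAt δ c (OrePoly.C δ (θ b)) * scaledTheta δ g := by
  ext x
  rw [Module.End.mul_apply, Module.End.mul_apply, evalAt_C, evalAt_C, scaledTheta_apply,
    scaledTheta_apply, _root_.map_mul]
  ring

/-- The deformation `X ↦ δ + (c + g t) θ` of `ev_c`. -/
noncomputable def deform (δ : SkewDerivation θ) (c g : K) :
    OrePoly δ →+* (Module.End (constField δ) K)[X] :=
  OrePoly.lift δ (Polynomial.C.comp ((evalAt δ c).comp (OrePoly.C δ)))
    (Polynomial.C (pseudoLinear δ c) + Polynomial.C (scaledTheta δ g) * Polynomial.X) fun b => by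
      simp only [RingHom.comp_apply]
      rw [add_mul, mul_assoc, Polynomial.X_mul_C, ← mul_assoc, ← Polynomial.C_mul,
        ← Polynomial.C_mul, pseudoLinear_mul_C, scaledTheta_mul_C, mul_add, Polynomial.C_add,
        Polynomial.C_mul, Polynomial.C_mul, mul_assoc]
      abel

theorem deform_C (c g b : K) :
    deform δ c g (OrePoly.C δ b) = Polynomial.C (evalAt δ c (OrePoly.C δ b)) :=
  OrePoly.lift_C _ _ _ _

theorem deform_X (c g : K) : deform δ c g (OrePoly.X δ) =
    Polynomial.C (pseudoLinear δ c) + Polynomial.C (scaledTheta δ g) * Polynomial.X :=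
  OrePoly.lift_X _ _ _

theorem coeff_zero_deform (c g : K) (f : OrePoly δ) :
    (deform δ c g f).coeff 0 = evalAt δ c f := by
  have : (Polynomial.constantCoeff).comp (deform δ c g) = evalAt δ c :=
    OrePoly.ringHom_ext (fun b => by simp [deform_C]) (by simp [deform_X, evalAt_X])
  exact RingHom.congr_fun this f

/-- Commuting with K makes φ the multiplication by φ(1); commuting with δ + cθ then makes φ(1) a
constant. -/
theorem exists_algebraMap_of_commute {c : K} (hc : ¬ IsRamified δ c)
    {φ : Module.End (constField δ) K}
    (hC : ∀ b, φ * evalAt δ c (OrePoly.C δ b) = evalAt δ c (OrePoly.C δ b) * φ)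
    (hX : φ * pseudoLinear δ c = pseudoLinear δ c * φ) :
    φ ∈ Set.range (algebraMap (constField δ) (Module.End (constField δ) K)) := by
  have h1 (b : K) : φ b = b * φ 1 := by
    have h := LinearMap.congr_fun (hC b) 1
    rwa [Module.End.mul_apply, Module.End.mul_apply, evalAt_C, evalAt_C, mul_one] at h
  have h2 := LinearMap.congr_fun hX 1
  rw [Module.End.mul_apply, Module.End.mul_apply, h1 (pseudoLinear δ c 1)] at h2
  refine ⟨⟨φ 1, mem_constField_of_pseudoLinear_mul hc one_ne_zero ?_⟩, ?_⟩
  · rw [mul_one, ← h2, mul_comm]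
  · ext b
    exact (mul_comm _ _).trans (h1 b).symm

variable [FiniteDimensional (constField δ) K]

/-- The derivative of `υ` at an unramified point does not vanish identically. -/
theorem exists_coeff_one_deform_ne_zero {c : K} (hc : ¬ IsRamified δ c) :
    ∃ g, (deform δ c g (modulus δ c)).coeff 1 ≠ 0 := by
  -- L kills 1, and K is finite over F, so L is not onto. Any g outside its image will do.
  let L : K →ₗ[constField δ] K := evalAt δ c (OrePoly.C δ c) - pseudoLinear δ c
  have hL (u : K) : L u = c * u - pseudoLinear δ c u := by
    change evalAt δ c (OrePoly.C δ c) u - pseudoLinear δ c u = _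
    rw [evalAt_C]
  have hns : ¬ Function.Surjective L := fun hs => by
    have hi := LinearMap.injective_iff_surjective.mpr hs
    refine one_ne_zero (hi (a₁ := (1 : K)) (a₂ := 0) ?_)
    rw [hL, _root_.map_zero, pseudoLinear_one, mul_one, sub_self]
  simp only [Function.Surjective, not_forall] at hns
  obtain ⟨g, hg⟩ := hns
  refine ⟨g, fun hN => hg ?_⟩
  -- Since the constant term of the deformation is ev_c, its linear term is a derivation along ev_c.
  -- If it vanishes at the modulus, it depends on f only through ev_c(f), which is `hwd`.
  have hmul (f f' : OrePoly δ) : (deform δ c g (f * f')).coeff 1 =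
      evalAt δ c f * (deform δ c g f').coeff 1 + (deform δ c g f).coeff 1 * evalAt δ c f' := by
    rw [_root_.map_mul, Polynomial.mul_coeff_one, coeff_zero_deform, coeff_zero_deform]
  have hwd (f f' : OrePoly δ) (h : evalAt δ c f = evalAt δ c f') :
      (deform δ c g f).coeff 1 = (deform δ c g f').coeff 1 := by
    obtain ⟨q, hq⟩ := exists_eq_mul_modulus hc (f := f - f') (by
      rw [_root_.map_sub, h, sub_self])
    rw [← sub_eq_zero, ← Polynomial.coeff_sub, ← _root_.map_sub, hq, hmul, hN, evalAt_modulus,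
      mul_zero, mul_zero, add_zero]
  -- With ℓ(1) = 1, `p x` lifts the rank-one map v ↦ ℓ(v) x. Applying the derivation to `p x` and
  -- evaluating at 1 defines u, and `key` says that the derivation is the commutator with u.
  obtain ⟨ℓ, -, hℓ⟩ := LinearMap.exists_extend_of_notMem (p := (⊥ : Submodule (constField δ) K))
    (v := (1 : K)) (0 : _ →ₗ[constField δ] constField δ) (by simp) 1
  choose p hp using fun x : K => evalAt_surjective hc (ℓ.smulRight x)
  have hp1 (x : K) : evalAt δ c (p x) 1 = x := by
    rw [hp, LinearMap.smulRight_apply, hℓ, one_smul]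
  set u : K → K := fun x => (deform δ c g (p x)).coeff 1 1 with hu
  have key (f : OrePoly δ) (x : K) : u (evalAt δ c f x) =
      evalAt δ c f (u x) + (deform δ c g f).coeff 1 x := by
    have h1 := hwd (p (evalAt δ c f x)) (f * p x) (by
      rw [_root_.map_mul, hp, hp]
      ext v
      simp)
    simp only [hu]
    rw [h1, hmul, LinearMap.add_apply, Module.End.mul_apply, Module.End.mul_apply, hp1]
  -- The derivation vanishes on constants, so u is K-linear. Then `key` for X at the vector 1 gives
  -- g = L(u 1), against the choice of g.
  have hu1 (b : K) : u b = b * u 1 := by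
    have h1 := key (OrePoly.C δ b) 1
    rwa [evalAt_C, evalAt_C, mul_one, deform_C, Polynomial.coeff_C_succ, LinearMap.zero_apply,
      add_zero] at h1
  refine ⟨u 1, ?_⟩
  have h1 := key (OrePoly.X δ) 1
  rw [evalAt_X, pseudoLinear_one, hu1, deform_X, Polynomial.coeff_add, Polynomial.coeff_C_succ,
    zero_add, Polynomial.coeff_mul_X, Polynomial.coeff_C_zero, scaledTheta_apply, _root_.map_one,
    mul_one] at h1
  rw [hL, h1, add_sub_cancel_left]

/-- Compare coefficients of index n + 1 in the relation expressing that the modulus commutes with X.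
The coefficient of index n is already a scalar, so it commutes with gθ and its contributions cancel;
the next one therefore commutes with δ + cθ, and with K because the deformation is constant on K. -/
theorem coeff_deform_modulus_mem {c : K} (hc : ¬ IsRamified δ c) (g : K) (n : ℕ) :
    (deform δ c g (modulus δ c)).coeff n ∈
      Set.range (algebraMap (constField δ) (Module.End (constField δ) K)) := by
  induction n with
  | zero =>
    rw [coeff_zero_deform, evalAt_modulus]
    exact ⟨0, _root_.map_zero _⟩
  | succ n ih =>
    refine exists_algebraMap_of_commute hc (fun b => ?_) ?_
    · have h := congrArg (fun p => Polynomial.coeff p (n + 1))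
        (congrArg (deform δ c g) (modulus_commute hc (OrePoly.C δ b)).eq)
      simpa only [_root_.map_mul, deform_C, Polynomial.coeff_mul_C, Polynomial.coeff_C_mul] using h
    · have h := congrArg (fun p => Polynomial.coeff p (n + 1))
        (congrArg (deform δ c g) (modulus_commute hc (OrePoly.X δ)).eq)
      obtain ⟨a, ha⟩ := ih
      simp only [_root_.map_mul, deform_X, mul_add, add_mul, Polynomial.coeff_add,
        Polynomial.coeff_mul_C, Polynomial.coeff_C_mul, ← mul_assoc, Polynomial.coeff_mul_X] at h
      rw [mul_assoc (Polynomial.C (scaledTheta δ g)), Polynomial.X_mul, ← mul_assoc,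
        Polynomial.coeff_mul_X, Polynomial.coeff_C_mul, ← ha, Algebra.commutes] at h
      exact add_right_cancel h

/-- A Taylor expansion of Ore polynomials, with coefficients in `End_F(K)`. -/
theorem exists_taylor_end {c : K} (hc : ¬ IsRamified δ c) :
    ∃ Φ : OrePoly δ →+* PowerSeries (Module.End (constField δ) K),
      (∀ b, Φ (OrePoly.C δ b) = PowerSeries.C (evalAt δ c (OrePoly.C δ b))) ∧
      Φ (modulus δ c) = PowerSeries.X ∧
      ∀ f, PowerSeries.constantCoeff (Φ f) = evalAt δ c f := by
  obtain ⟨g, hg⟩ := exists_coeff_one_deform_ne_zero hc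
  set ι := algebraMap (constField δ) (Module.End (constField δ) K) with hι
  obtain ⟨h, hh⟩ : deform δ c g (modulus δ c) ∈ Polynomial.lifts ι :=
    (Polynomial.lifts_iff_coeff_lifts _).mpr (coeff_deform_modulus_mem hc g)
  rw [Polynomial.coe_mapRingHom] at hh
  have hco (n : ℕ) : ι (h.coeff n) = (deform δ c g (modulus δ c)).coeff n := by
    rw [← hh, Polynomial.coeff_map]
  obtain ⟨τ, hτ0, hτ⟩ := exists_powerSeries_root h
    (ι.injective (by rw [hco, coeff_zero_deform, evalAt_modulus, _root_.map_zero]))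
    (fun h0 => hg (by rw [← hco, h0, _root_.map_zero]))
  have hcomm (a : Module.End (constField δ) K) :
      Commute (PowerSeries.C a) (PowerSeries.map ι τ) := by
    ext n : 1
    rw [PowerSeries.coeff_C_mul, PowerSeries.coeff_mul_C, PowerSeries.coeff_map,
      Algebra.commutes]
  -- Substituting τ for t is multiplicative because τ has coefficients in F, which are central in
  -- End_F(K).
  let Φ := (Polynomial.eval₂RingHom' PowerSeries.C (PowerSeries.map ι τ) hcomm).comp
    (deform δ c g)
  have hΦ (f : OrePoly δ) : Φ f =
    (deform δ c g f).eval₂ PowerSeries.C (PowerSeries.map ι τ) := rfl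
  have hΦC (b : K) : Φ (OrePoly.C δ b) = PowerSeries.C (evalAt δ c (OrePoly.C δ b)) := by
    rw [hΦ, deform_C, Polynomial.eval₂_C]
  refine ⟨Φ, hΦC, ?_, fun f => ?_⟩
  · rw [hΦ, ← hh, Polynomial.eval₂_map, ← PowerSeries.map_X ι, ← hτ, Polynomial.hom_eval₂]
    congr 1
    ext a : 1
    exact (PowerSeries.map_C _ _).symm
  · have : (PowerSeries.constantCoeff).comp Φ = evalAt δ c := by
      refine OrePoly.ringHom_ext (fun b => ?_) ?_
      · rw [RingHom.comp_apply, hΦC, PowerSeries.constantCoeff_C]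
      · have h1 : PowerSeries.constantCoeff (PowerSeries.map ι τ) = 0 := by
          rw [← PowerSeries.coeff_zero_eq_constantCoeff_apply, PowerSeries.coeff_map,
            PowerSeries.coeff_zero_eq_constantCoeff_apply, hτ0, _root_.map_zero]
        have h2 : Φ (OrePoly.X δ) = PowerSeries.C (pseudoLinear δ c) +
            PowerSeries.C (scaledTheta δ g) * PowerSeries.map ι τ := by
          rw [hΦ, deform_X, Polynomial.eval₂_add, Polynomial.eval₂_C,
            Polynomial.eval₂_mul_X, Polynomial.eval₂_C]
        rw [RingHom.comp_apply, h2, _root_.map_add, _root_.map_mul, h1, mul_zero, add_zero,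
          PowerSeries.constantCoeff_C, evalAt_X]
    exact RingHom.congr_fun this f

end Deformation

/-! ### The quotients by powers of N, and transport of the expansion to the residue ring. -/

section Completion

variable {K : Type*} [Field K] {θ : K →+* K} {δ : SkewDerivation θ}
  [FiniteDimensional (constField δ) K]

theorem toQuotPow_surjective (c : K) (r : ℕ) : Function.Surjective (toQuotPow δ c r) :=
  RingCon.mk'_surjective _

/-- As N is central, the left multiples of N ^ r already form a two-sided ideal. -/
theorem toQuotPow_eq_zero {c : K} (hc : ¬ IsRamified δ c) {r : ℕ} {f : OrePoly δ} :
    toQuotPow δ c r f = 0 ↔ ∃ g, f = g * modulus δ c ^ r := by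
  have hN (P : OrePoly δ) : Commute (modulus δ c ^ r) P := (modulus_commute hc P).pow_left r
  have h1 : toQuotPow δ c r f = 0 ↔ f ∈ modIdeal δ c r := by
    conv_rhs => rw [← TwoSidedIdeal.ker_ringCon_mk' (modIdeal δ c r)]
    exact (TwoSidedIdeal.mem_ker _).symm
  rw [h1]
  constructor
  · intro hf
    let I : TwoSidedIdeal (OrePoly δ) := TwoSidedIdeal.mk' {f | ∃ g, f = g * modulus δ c ^ r}
      ⟨0, by rw [zero_mul]⟩
      (by rintro _ _ ⟨g, rfl⟩ ⟨g', rfl⟩; exact ⟨g + g', by rw [add_mul]⟩)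
      (by rintro _ ⟨g, rfl⟩; exact ⟨-g, by rw [neg_mul]⟩)
      (by rintro x _ ⟨g, rfl⟩; exact ⟨x * g, by rw [mul_assoc]⟩)
      (by rintro _ y ⟨g, rfl⟩; exact ⟨g * y, by rw [mul_assoc, (hN y).eq, mul_assoc]⟩)
    have hI (x : OrePoly δ) : x ∈ I ↔ ∃ g, x = g * modulus δ c ^ r :=
      TwoSidedIdeal.mem_mk' _ _ _ _ _ _ _
    exact (hI f).mp (TwoSidedIdeal.mem_span_iff.mp hf I
      (Set.singleton_subset_iff.mpr ((hI _).mpr ⟨1, by rw [one_mul]⟩)))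
  · rintro ⟨g, rfl⟩
    exact TwoSidedIdeal.mul_mem_left _ _ _ (TwoSidedIdeal.subset_span rfl)

theorem toQuotPow_eq_iff {c : K} (hc : ¬ IsRamified δ c) {r : ℕ} {f g : OrePoly δ} :
    toQuotPow δ c r f = toQuotPow δ c r g ↔ ∃ q, f - g = q * modulus δ c ^ r := by
  rw [← toQuotPow_eq_zero hc, _root_.map_sub, sub_eq_zero]

theorem evalRes_bijective {c : K} (hc : ¬ IsRamified δ c) :
    Function.Bijective (evalRes δ c) := by
  constructor
  · rw [injective_iff_map_eq_zero]
    intro x hx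
    obtain ⟨f, rfl⟩ := toQuotPow_surjective c 1 x
    rw [evalRes_mk] at hx
    rw [toQuotPow_eq_zero hc, pow_one]
    exact exists_eq_mul_modulus hc hx
  · intro φ
    obtain ⟨f, rfl⟩ := evalAt_surjective hc φ
    exact ⟨toQuotPow δ c 1 f, evalRes_mk δ c f⟩

/-- A Taylor expansion of Ore polynomials, with coefficients in the residue ring. -/
theorem exists_taylor_resRing {c : K} (hc : ¬ IsRamified δ c) :
    ∃ Φ : OrePoly δ →+* PowerSeries (ResRing δ c),
      (∀ b, Φ (OrePoly.C δ b) = PowerSeries.C (toQuotPow δ c 1 (OrePoly.C δ b))) ∧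
      Φ (modulus δ c) = PowerSeries.X ∧
      ∀ f, PowerSeries.constantCoeff (Φ f) = toQuotPow δ c 1 f := by
  obtain ⟨Φ, h1, h2, h3⟩ := exists_taylor_end hc
  let e := RingEquiv.ofBijective (evalRes δ c) (evalRes_bijective hc)
  have he (f : OrePoly δ) : e.symm.toRingHom (evalAt δ c f) = toQuotPow δ c 1 f :=
    e.symm_apply_eq.mpr (evalRes_mk δ c f).symm
  refine ⟨(PowerSeries.map e.symm.toRingHom).comp Φ, fun b => ?_, ?_, fun f => ?_⟩
  · rw [RingHom.comp_apply, h1, PowerSeries.map_C, he]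
  · rw [RingHom.comp_apply, h2, PowerSeries.map_X]
  · rw [← PowerSeries.coeff_zero_eq_constantCoeff_apply, RingHom.comp_apply,
      PowerSeries.coeff_map, PowerSeries.coeff_zero_eq_constantCoeff_apply, h3, he]

end Completion

/-! ### Existence of admissible isomorphisms and of Taylor expansions. -/

section Admissible

variable {K : Type*} [Field K] {θ : K →+* K} {δ : SkewDerivation θ}
  [FiniteDimensional (constField δ) K]

/-- The definition of the completion compares consecutive levels only; compatibility between
arbitrary levels follows by descent. -/
theorem toQuotPow_of_le {c : K} (hc : ¬ IsRamified δ c) (x : Completion δ c) {n : ℕ}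
    {f : OrePoly δ} (hf : toQuotPow δ c n f = x.1 n) {i : ℕ} (hi : i ≤ n) :
    toQuotPow δ c i f = x.1 i := by
  induction n, hi using Nat.le_induction with
  | base => exact hf
  | succ n hn ih =>
    refine ih ?_
    obtain ⟨f', h1, h2⟩ := x.2 n
    rw [← h1, toQuotPow_eq_iff hc]
    rw [← h2, toQuotPow_eq_iff hc] at hf
    obtain ⟨q, hq⟩ := hf
    exact ⟨q * modulus δ c, by rw [hq, pow_succ', mul_assoc]⟩

theorem coeff_eq_of_toQuotPow_eq {c : K} (hc : ¬ IsRamified δ c)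
    {Φ : OrePoly δ →+* PowerSeries (ResRing δ c)} (hN : Φ (modulus δ c) = PowerSeries.X) {n : ℕ}
    {f g : OrePoly δ} (h : toQuotPow δ c n f = toQuotPow δ c n g) {i : ℕ} (hi : i < n) :
    PowerSeries.coeff i (Φ f) = PowerSeries.coeff i (Φ g) := by
  obtain ⟨q, hq⟩ := (toQuotPow_eq_iff hc).mp h
  rw [← sub_eq_zero, ← _root_.map_sub, ← _root_.map_sub, hq, _root_.map_mul, _root_.map_pow, hN,
    PowerSeries.coeff_mul_X_pow', if_neg (by omega)]

/-- A vanishing constant coefficient allows one factor N to be split off, and this shifts the series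
by one. -/
theorem exists_eq_mul_pow_of_coeff_eq_zero {c : K} (hc : ¬ IsRamified δ c)
    {Φ : OrePoly δ →+* PowerSeries (ResRing δ c)} (hN : Φ (modulus δ c) = PowerSeries.X)
    (h0 : ∀ f, PowerSeries.constantCoeff (Φ f) = toQuotPow δ c 1 f) (n : ℕ) (f : OrePoly δ)
    (hf : ∀ i < n, PowerSeries.coeff i (Φ f) = 0) : ∃ g, f = g * modulus δ c ^ n := by
  induction n generalizing f with
  | zero => exact ⟨f, by rw [pow_zero, mul_one]⟩
  | succ n ih =>
    have h1 : toQuotPow δ c 1 f = 0 := by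
      rw [← h0, ← PowerSeries.coeff_zero_eq_constantCoeff_apply]
      exact hf 0 (Nat.succ_pos n)
    obtain ⟨g, rfl⟩ := (toQuotPow_eq_zero hc).mp h1
    rw [pow_one] at hf ⊢
    obtain ⟨q, rfl⟩ := ih g fun i hi => by
      have h2 := hf (i + 1) (by omega)
      rwa [_root_.map_mul, hN, PowerSeries.coeff_succ_mul_X] at h2
    exact ⟨q, by rw [pow_succ, mul_assoc]⟩

/-- A Taylor expansion `K[X; θ, δ] → R[[T]]` induces an admissible isomorphism. -/
theorem nonempty_admissibleIso {c : K} (hc : ¬ IsRamified δ c) : Nonempty (AdmissibleIso δ c) := by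
  obtain ⟨Φ, hC, hN, h0⟩ := exists_taylor_resRing hc
  choose lift hlift using fun (x : Completion δ c) n => toQuotPow_surjective c n (x.1 n)
  -- The coefficient of index n is determined modulo N ^ (n + 1). By `hρ` any sufficiently precise
  -- lift computes it, so ρ is a ring homomorphism although the lifts are not additive.
  let ρ : Completion δ c → PowerSeries (ResRing δ c) := fun x =>
    PowerSeries.mk fun n => PowerSeries.coeff n (Φ (lift x (n + 1)))
  have hρ (x : Completion δ c) (n : ℕ) (f : OrePoly δ) (hf : toQuotPow δ c n f = x.1 n) (i : ℕ)
      (hi : i < n) : PowerSeries.coeff i (ρ x) = PowerSeries.coeff i (Φ f) := by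
    rw [PowerSeries.coeff_mk]
    exact coeff_eq_of_toQuotPow_eq hc hN (n := i + 1)
      ((hlift x (i + 1)).trans (toQuotPow_of_le hc x hf hi).symm) (Nat.lt_succ_self i)
  have hρf (f : OrePoly δ) : ρ (toCompletion δ c f) = Φ f := by
    ext n : 1
    exact hρ _ (n + 1) f rfl n (Nat.lt_succ_self n)
  let ρhom : Completion δ c →+* PowerSeries (ResRing δ c) :=
    { toFun := ρ
      map_zero' := by
        rw [← _root_.map_zero (toCompletion δ c), hρf, _root_.map_zero]
      map_one' := by
        rw [← _root_.map_one (toCompletion δ c), hρf, _root_.map_one]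
      map_add' := fun x y => by
        ext n : 1
        have h1 := hρ (x + y) (n + 1) (lift x (n + 1) + lift y (n + 1))
          (by rw [_root_.map_add, hlift, hlift]; rfl) n (Nat.lt_succ_self n)
        rw [h1, _root_.map_add, _root_.map_add, _root_.map_add,
          hρ x (n + 1) _ (hlift x _) n (Nat.lt_succ_self n),
          hρ y (n + 1) _ (hlift y _) n (Nat.lt_succ_self n)]
      map_mul' := fun x y => by
        ext n : 1
        have h1 := hρ (x * y) (n + 1) (lift x (n + 1) * lift y (n + 1))
          (by rw [_root_.map_mul, hlift, hlift]; rfl) n (Nat.lt_succ_self n)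
        rw [h1, _root_.map_mul, PowerSeries.coeff_mul, PowerSeries.coeff_mul]
        refine Finset.sum_congr rfl fun ij hij => ?_
        rw [Finset.HasAntidiagonal.mem_antidiagonal] at hij
        rw [hρ x (n + 1) _ (hlift x _) ij.1 (by omega),
          hρ y (n + 1) _ (hlift y _) ij.2 (by omega)] }
  have hinj : Function.Injective ρhom := by
    rw [injective_iff_map_eq_zero]
    intro x hx
    have hx' : ρ x = 0 := hx
    refine Subtype.ext (funext fun n => ?_)
    rw [← hlift x n]
    refine (toQuotPow_eq_zero hc).mpr
      (exists_eq_mul_pow_of_coeff_eq_zero hc hN h0 n _ fun i hi => ?_)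
    rw [← hρ x n _ (hlift x n) i hi, hx', _root_.map_zero]
  have hsurj : Function.Surjective ρhom := by
    intro p
    have happrox (n : ℕ) : ∃ f : OrePoly δ,
        ∀ i < n, PowerSeries.coeff i (Φ f) = PowerSeries.coeff i p := by
      induction n with
      | zero => exact ⟨0, fun i hi => absurd hi (Nat.not_lt_zero i)⟩
      | succ n ih =>
        obtain ⟨f, hf⟩ := ih
        -- Adding g N ^ n leaves the earlier coefficients alone and changes the one of index n by
        -- the class of g.
        obtain ⟨g, hg⟩ := toQuotPow_surjective c 1
          (PowerSeries.coeff n p - PowerSeries.coeff n (Φ f))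
        refine ⟨f + g * modulus δ c ^ n, fun i hi => ?_⟩
        rw [_root_.map_add, _root_.map_add, _root_.map_mul, _root_.map_pow, hN,
          PowerSeries.coeff_mul_X_pow']
        rcases (Nat.lt_succ_iff.mp hi).lt_or_eq with h | rfl
        · rw [if_neg (by omega), add_zero, hf i h]
        · rw [if_pos le_rfl, Nat.sub_self, PowerSeries.coeff_zero_eq_constantCoeff_apply, h0, hg,
            add_sub_cancel]
    choose f hf using happrox
    let x : Completion δ c := ⟨fun n => toQuotPow δ c n (f n), fun n => ⟨f (n + 1), by
      rw [toQuotPow_eq_iff hc]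
      refine exists_eq_mul_pow_of_coeff_eq_zero hc hN h0 n _ fun i hi => ?_
      rw [_root_.map_sub, _root_.map_sub, hf (n + 1) i (by omega), hf n i hi, sub_self], rfl⟩⟩
    refine ⟨x, ?_⟩
    ext n : 1
    exact (hρ x (n + 1) (f (n + 1)) rfl n (Nat.lt_succ_self n)).trans
      (hf (n + 1) n (Nat.lt_succ_self n))
  exact ⟨{ RingEquiv.ofBijective ρhom ⟨hinj, hsurj⟩ with
    map_const := fun a => (hρf _).trans (hC a)
    map_modulus := (hρf _).trans hN
    reduction := fun x => by
      change PowerSeries.constantCoeff (ρ x) = x.1 1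
      rw [← PowerSeries.coeff_zero_eq_constantCoeff_apply, hρ x 1 _ (hlift x 1) 0 Nat.one_pos,
        PowerSeries.coeff_zero_eq_constantCoeff_apply, h0, hlift] }⟩

/-- The map on Ore polynomials given by an admissible isomorphism. -/
noncomputable def AdmissibleIso.onPoly {c : K} (e : AdmissibleIso δ c) :
    OrePoly δ →+* PowerSeries (ResRing δ c) :=
  e.toRingEquiv.toRingHom.comp (toCompletion δ c)

theorem AdmissibleIso.onPoly_modulus {c : K} (e : AdmissibleIso δ c) :
    e.onPoly (modulus δ c) = PowerSeries.X := e.map_modulus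

theorem AdmissibleIso.constantCoeff_onPoly {c : K} (e : AdmissibleIso δ c) (f : OrePoly δ) :
    PowerSeries.constantCoeff (e.onPoly f) = toQuotPow δ c 1 f := e.reduction _

/-- Modulo N, the element q(Z) is the nonzero constant q(z). -/
theorem isUnit_toQuotPow_centralHom {c : K} (hc : ¬ IsRamified δ c) {q : (constField δ)[X]}
    (hq : q.eval (ups hc) ≠ 0) : IsUnit (toQuotPow δ c 1 (centralHom δ q)) := by
  have h : toQuotPow δ c 1 (centralHom δ q) =
      toQuotPow δ c 1 (OrePoly.C δ (q.eval (ups hc) : constField δ)) := by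
    refine (evalRes_bijective hc).1 ?_
    rw [evalRes_mk, evalRes_mk, evalAt_centralHom hc, evalAt_C_eq]; rfl
  rw [h]
  refine IsUnit.map (toQuotPow δ c 1) (IsUnit.map (OrePoly.C δ) (isUnit_iff_ne_zero.mpr ?_))
  exact fun h0 => hq (Subtype.ext h0)

theorem exists_mul_eq_one_of_isUnit_constantCoeff {R : Type*} [Ring R] {φ : PowerSeries R}
    (h : IsUnit (PowerSeries.constantCoeff φ)) : ∃ ψ, φ * ψ = 1 ∧ ψ * φ = 1 :=
  ⟨φ.invOfUnit h.unit, PowerSeries.mul_invOfUnit _ _ rfl, PowerSeries.invOfUnit_mul _ _ rfl⟩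

/-- Every nonzero Ore polynomial divides a nonzero central one. -/
theorem exists_mul_eq_centralHom {f : OrePoly δ} (hf : f ≠ 0) :
    ∃ p : (constField δ)[X], p ≠ 0 ∧ ∃ g, g * f = centralHom δ p := by
  let ρ : OrePoly δ →ₗ[K] OrePoly δ :=
    { toFun := fun g => g * f
      map_add' := fun g g' => add_mul g g' f
      map_smul' := fun a g => OrePoly.smul_mul' δ a g f }
  let W := LinearMap.range ρ
  have hfinK : Module.Finite K (OrePoly δ ⧸ W) := by
    have := (OrePoly.finrank_degreeLT (δ := δ) f.natDegree).1
    refine Module.Finite.of_surjective (W.mkQ.domRestrict (OrePoly.degreeLT δ f.natDegree)) ?_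
    intro x
    obtain ⟨h, rfl⟩ := W.mkQ_surjective x
    obtain ⟨q, r, hqr, hr⟩ := OrePoly.exists_div f hf h
    refine ⟨⟨r, hr⟩, ?_⟩
    change W.mkQ r = W.mkQ h
    rw [← sub_eq_zero, ← _root_.map_sub, hqr, Submodule.mkQ_apply,
      Submodule.Quotient.mk_eq_zero]
    exact ⟨-q, by change -q * f = _; rw [neg_mul]; abel⟩
  have hfinF : Module.Finite (constField δ) (OrePoly δ ⧸ W) := Module.Finite.trans K _
  let ψ : (constField δ)[X] →ₗ[constField δ] OrePoly δ ⧸ W :=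
    { toFun := fun p => W.mkQ (centralHom δ p)
      map_add' := fun p q => by rw [_root_.map_add, _root_.map_add]
      map_smul' := fun a p => by
        rw [Polynomial.smul_eq_C_mul, _root_.map_mul, centralHom_C, OrePoly.C_mul,
          _root_.map_smul]
        rfl }
  -- The quotient by left multiples of f is finite over K, hence over F, while F[x] is not. A
  -- nonzero p in the kernel gives p(Z) as a left multiple of f.
  have hψ : ¬ Function.Injective ψ := fun h =>
    Polynomial.not_finite (R := constField δ) (Module.Finite.of_injective ψ h)
  rw [injective_iff_map_eq_zero] at hψ
  push Not at hψ
  obtain ⟨p, hp, hp0⟩ := hψ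
  obtain ⟨g, hg⟩ := (Submodule.Quotient.mk_eq_zero W).mp hp
  exact ⟨p, hp0, g, hg⟩

theorem isUnit_single {R : Type*} [Ring R] :
    IsUnit (HahnSeries.single (1 : ℤ) (1 : R)) :=
  isUnit_iff_exists_and_exists.mpr
    ⟨⟨HahnSeries.single (-1) 1, by rw [HahnSeries.single_mul_single]; simp⟩,
      ⟨HahnSeries.single (-1) 1, by rw [HahnSeries.single_mul_single]; simp⟩⟩

theorem isUnit_ofPowerSeries {R : Type*} [Ring R] {φ : PowerSeries R}
    (h : IsUnit (PowerSeries.constantCoeff φ)) : IsUnit (HahnSeries.ofPowerSeries ℤ R φ) :=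
  IsUnit.map _ (PowerSeries.isUnit_iff_constantCoeff.mpr h)

theorem AdmissibleIso.isUnit_onPoly {c : K} (hc : ¬ IsRamified δ c) (e : AdmissibleIso δ c)
    {f : OrePoly δ} (hf : f ≠ 0) :
    IsUnit (HahnSeries.ofPowerSeries ℤ (ResRing δ c) (e.onPoly f)) := by
  obtain ⟨p, hp, g, hg⟩ := exists_mul_eq_centralHom hf
  have hfg : f * g = centralHom δ p := by
    refine mul_right_cancel₀ hf ?_
    rw [mul_assoc, hg, (centralHom_commute p f).eq]
  have hunit : IsUnit (HahnSeries.ofPowerSeries ℤ (ResRing δ c)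
      (e.onPoly (centralHom δ p))) := by
    -- Write p = (x - z)^r q with q(z) ≠ 0: the first factor becomes T ^ r and q(Z) a series with
    -- invertible constant coefficient.
    obtain ⟨q, hq, hndvd⟩ := Polynomial.exists_eq_pow_rootMultiplicity_mul_and_not_dvd p hp (ups hc)
    rw [hq, _root_.map_mul, _root_.map_pow, ← modulus_eq hc, _root_.map_mul, _root_.map_mul,
      _root_.map_pow, _root_.map_pow, e.onPoly_modulus, HahnSeries.ofPowerSeries_X]
    refine (isUnit_single.pow _).mul (isUnit_ofPowerSeries ?_)
    rw [e.constantCoeff_onPoly]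
    exact isUnit_toQuotPow_centralHom hc fun h => hndvd (Polynomial.dvd_iff_isRoot.mpr h)
  -- Centrality gives f g = g f = p(Z), so f has an inverse on each side.
  have h1 := hunit
  rw [← hg, _root_.map_mul, _root_.map_mul] at h1
  have h2 := hunit
  rw [← hfg, _root_.map_mul, _root_.map_mul] at h2
  obtain ⟨u, hu⟩ := h1
  obtain ⟨v, hv⟩ := h2
  refine isUnit_iff_exists_and_exists.mpr
    ⟨⟨HahnSeries.ofPowerSeries ℤ (ResRing δ c) (e.onPoly g) * (v⁻¹ : Units _), ?_⟩,
      ⟨(u⁻¹ : Units _) * HahnSeries.ofPowerSeries ℤ (ResRing δ c) (e.onPoly g), ?_⟩⟩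
  · rw [← mul_assoc, ← hv, Units.mul_inv]
  · rw [mul_assoc, ← hu, Units.inv_mul]

theorem nonempty_taylorExpansion {c : K} (hc : ¬ IsRamified δ c) :
    Nonempty (TaylorExpansion δ c) := by
  obtain ⟨e⟩ := nonempty_admissibleIso hc
  let L : OrePoly δ →+* LaurentSeries (ResRing δ c) :=
    (HahnSeries.ofPowerSeries ℤ (ResRing δ c)).comp e.onPoly
  have hL (s : nonZeroDivisors (OrePoly δ)) : IsUnit (L s) :=
    e.isUnit_onPoly hc (nonZeroDivisors.coe_ne_zero s)
  let fS : nonZeroDivisors (OrePoly δ) →* (LaurentSeries (ResRing δ c))ˣ :=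
    IsUnit.liftRight (L.toMonoidHom.comp (nonZeroDivisors (OrePoly δ)).subtype) hL
  exact ⟨⟨e, OreLocalization.universalHom L fS fun s => rfl, fun f =>
    OreLocalization.universalHom_commutes L fS fun s => rfl⟩⟩

end Admissible

/-! ### Residues at simple poles. -/

section Residue

variable {K : Type*} [Field K] {θ : K →+* K} {δ : SkewDerivation θ}
  [FiniteDimensional (constField δ) K]

theorem ofPowerSeries_mul_single {R : Type*} [Ring R] (φ : PowerSeries R) (n : ℤ) :
    HahnSeries.ofPowerSeries ℤ R φ * HahnSeries.single n 1 =
      HahnSeries.single n 1 * HahnSeries.ofPowerSeries ℤ R φ := by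
  ext i
  rw [HahnSeries.coeff_mul_single, HahnSeries.coeff_single_mul, one_mul, mul_one]

/-- The skew residue of a fraction with a simple pole. -/
theorem TaylorExpansion.evalRes_sres {c : K} (hc : ¬ IsRamified δ c) (TS : TaylorExpansion δ c)
    {f : OreFrac δ} {G : OrePoly δ} {q : (constField δ)[X]} (hq : q.eval (ups hc) ≠ 0)
    (h : f * toFrac δ (centralHom δ q * modulus δ c) = toFrac δ G) :
    q.eval (ups hc) • evalRes δ c (TS.sres f) = evalAt δ c G := by
  have hext (P : OrePoly δ) : TS.toLaurent (toFrac δ P) =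
      HahnSeries.ofPowerSeries ℤ (ResRing δ c) (TS.iso.onPoly P) := TS.extends_iso P
  have h1 := congrArg TS.toLaurent h
  rw [_root_.map_mul, hext, hext, _root_.map_mul, TS.iso.onPoly_modulus, _root_.map_mul,
    HahnSeries.ofPowerSeries_X] at h1
  set φ := TS.iso.onPoly (centralHom δ q) with hφ
  have hφ0 : PowerSeries.constantCoeff φ = toQuotPow δ c 1 (centralHom δ q) :=
    TS.iso.constantCoeff_onPoly _
  obtain ⟨ψ, hψ, hψ'⟩ := exists_mul_eq_one_of_isUnit_constantCoeff (φ := φ)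
    (hφ0 ▸ isUnit_toQuotPow_centralHom hc hq)
  have h2 : TS.toLaurent f = HahnSeries.single (-1) 1 *
      HahnSeries.ofPowerSeries ℤ (ResRing δ c) (TS.iso.onPoly G * ψ) := by
    have h3 : (HahnSeries.ofPowerSeries ℤ (ResRing δ c) φ * HahnSeries.single 1 1) *
        (HahnSeries.single (-1) 1 * HahnSeries.ofPowerSeries ℤ (ResRing δ c) ψ) = 1 := by
      rw [mul_assoc, ← mul_assoc (HahnSeries.single (1 : ℤ) (1 : ResRing δ c)),
        HahnSeries.single_mul_single, add_neg_cancel, one_mul, HahnSeries.single_zero_one, one_mul,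
        ← _root_.map_mul, hψ, _root_.map_one]
    calc TS.toLaurent f = TS.toLaurent f * 1 := (mul_one _).symm
      _ = _ := by
        rw [← h3, ← mul_assoc, h1, ← mul_assoc, ofPowerSeries_mul_single, mul_assoc,
          ← _root_.map_mul]
  -- After T^{-1} is factored out, only constant coefficients remain, and these are prescribed by
  -- reduction modulo N. Hence the residue does not depend on the expansion.
  have h3 : TS.sres f = toQuotPow δ c 1 G * PowerSeries.constantCoeff ψ := by
    rw [TaylorExpansion.sres, h2, HahnSeries.coeff_single_mul, one_mul, sub_self,
      ← TS.iso.constantCoeff_onPoly, ← _root_.map_mul,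
      ← PowerSeries.coeff_zero_eq_constantCoeff_apply]
    exact HahnSeries.ofPowerSeries_apply_coeff _ 0
  have h4 : TS.sres f * toQuotPow δ c 1 (centralHom δ q) = toQuotPow δ c 1 G := by
    rw [h3, ← hφ0, mul_assoc, ← _root_.map_mul, hψ', _root_.map_one, mul_one]
  have h5 := congrArg (evalRes δ c) h4
  rw [_root_.map_mul, evalRes_mk, evalRes_mk, evalAt_centralHom hc, mul_smul_comm, mul_one] at h5
  exact h5

end Residue

/-! ### The Singleton bound. -/

section Singleton

variable {F K : Type*} [Field F] [Field K] [Algebra F K] {m : ℕ}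
  {U : Fin m → Type*} [∀ i, AddCommGroup (U i)] [∀ i, Module F (U i)]

/-- The Singleton bound in the sum-rank metric, for the code parametrized by a linear map. -/
theorem exists_sumRankWeight_le [∀ i, FiniteDimensional F (U i)] {W : Type*} [AddCommGroup W]
    [Module K W] [FiniteDimensional K W] (Γ : W →ₗ[K] (∀ i, U i →ₗ[F] K))
    (hW : 0 < Module.finrank K W) (hle : Module.finrank K W ≤ ∑ i, Module.finrank F (U i)) :
    ∃ g : W, g ≠ 0 ∧
      sumRankWeight (Γ g) + Module.finrank K W ≤ ∑ i, Module.finrank F (U i) + 1 := by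
  classical
  have hcard : Fintype.card (Σ i, Fin (Module.finrank F (U i))) =
      ∑ i, Module.finrank F (U i) := by
    rw [Fintype.card_sigma]; simp
  -- Requiring a word to vanish on dim W - 1 basis vectors leaves a nonzero g; the images of the
  -- remaining basis vectors bound the ranks.
  obtain ⟨S, -, hS⟩ := Finset.exists_subset_card_eq
    (s := (Finset.univ : Finset (Σ i, Fin (Module.finrank F (U i)))))
    (n := Module.finrank K W - 1) (by rw [Finset.card_univ, hcard]; omega)
  let e : W →ₗ[K] (S → K) :=
    { toFun := fun g x => Γ g x.1.1 (Module.finBasis F (U x.1.1) x.1.2)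
      map_add' := fun g g' => by rw [_root_.map_add]; rfl
      map_smul' := fun a g => by rw [_root_.map_smul]; rfl }
  obtain ⟨g, hg, hg0⟩ := (Submodule.ne_bot_iff _).mp
    (LinearMap.ker_ne_bot_of_finrank_lt (f := e) (by
      rw [Module.finrank_fintype_fun_eq_card, Fintype.card_coe, hS]; omega))
  refine ⟨g, hg0, ?_⟩
  have hvan (i : Fin m) (j : Fin (Module.finrank F (U i)))
      (hij : (⟨i, j⟩ : Σ i, Fin (Module.finrank F (U i))) ∈ S) :
      Γ g i (Module.finBasis F (U i) j) = 0 := congrFun (LinearMap.mem_ker.mp hg) ⟨⟨i, j⟩, hij⟩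
  have hrank (i : Fin m) : Module.finrank F (LinearMap.range (Γ g i)) ≤
      (Finset.univ.filter fun j : Fin (Module.finrank F (U i)) =>
        (⟨i, j⟩ : Σ i, Fin (Module.finrank F (U i))) ∉ S).card := by
    set T := Finset.univ.filter fun j : Fin (Module.finrank F (U i)) =>
        (⟨i, j⟩ : Σ i, Fin (Module.finrank F (U i))) ∉ S with hT
    have hle : LinearMap.range (Γ g i) ≤
        Submodule.span F (T.image fun j => Γ g i (Module.finBasis F (U i) j) : Finset K) := by
      rw [LinearMap.range_eq_map, ← (Module.finBasis F (U i)).span_eq, Submodule.map_span,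
        Submodule.span_le]
      rintro _ ⟨_, ⟨j, rfl⟩, rfl⟩
      by_cases hj : (⟨i, j⟩ : Σ i, Fin (Module.finrank F (U i))) ∈ S
      · rw [hvan i j hj]; exact Submodule.zero_mem _
      · exact Submodule.subset_span (Finset.mem_coe.mpr (Finset.mem_image_of_mem _
          (Finset.mem_filter.mpr ⟨Finset.mem_univ _, hj⟩)))
    exact (Submodule.finrank_mono hle).trans
      ((finrank_span_finset_le_card _).trans Finset.card_image_le)
  have hsum : ∑ i, (Finset.univ.filter fun j : Fin (Module.finrank F (U i)) =>
        (⟨i, j⟩ : Σ i, Fin (Module.finrank F (U i))) ∉ S).card = Sᶜ.card := by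
    rw [← Finset.card_sigma]
    congr 1
    ext ⟨i, j⟩
    simp
  have hw : sumRankWeight (Γ g) ≤ Sᶜ.card := hsum ▸ Finset.sum_le_sum fun i _ => hrank i
  rw [Finset.card_compl, hcard, hS] at hw
  omega

end Singleton

/-! ### The divisor D and its cofactor in ∏ (Z(X) - z_i). -/

section Cofactor

variable {K : Type*} [Field K] {θ : K →+* K} {δ : SkewDerivation θ}

theorem eq_of_le_of_sum_finrank_le {F V ι : Type*} [Fintype ι] [Field F] [AddCommGroup V]
    [Module F V] [FiniteDimensional F V] {A B : ι → Submodule F V} (h : ∀ i, A i ≤ B i)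
    (hs : ∑ i, Module.finrank F (B i) ≤ ∑ i, Module.finrank F (A i)) (i : ι) : A i = B i := by
  have hle : ∀ i ∈ Finset.univ, Module.finrank F (A i) ≤ Module.finrank F (B i) :=
    fun i _ => Submodule.finrank_mono (h i)
  have heq := (Finset.sum_eq_sum_iff_of_le hle).mp (le_antisymm (Finset.sum_le_sum hle) hs)
  exact Submodule.eq_of_le_of_finrank_eq (h i) (heq i (Finset.mem_univ i))

theorem OrePoly.Monic.mul {P Q : OrePoly δ} (hP : P.Monic) (hQ : Q.Monic) : (P * Q).Monic := by
  have h2 := (OrePoly.coeff_mul_top P Q _ _ P.coeff_eq_zero_of_natDegree_lt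
    Q.coeff_eq_zero_of_natDegree_lt).2
  have h3 : P.coeff P.natDegree = 1 := hP
  have h4 : Q.coeff Q.natDegree = 1 := hQ
  rw [h3, h4, iterate_map_one, mul_one, ← OrePoly.natDegree_mul hP.ne_zero hQ.ne_zero] at h2
  exact h2

theorem OrePoly.monic_one : (1 : OrePoly δ).Monic := Polynomial.monic_one

theorem OrePoly.monic_X_add_C (a : K) : (OrePoly.X δ + OrePoly.C δ a).Monic :=
  Polynomial.monic_X_add_C a

theorem OrePoly.Monic.pow {P : OrePoly δ} (hP : P.Monic) (n : ℕ) : (P ^ n).Monic := by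
  induction n with
  | zero => rw [pow_zero]; exact OrePoly.monic_one
  | succ n ih => rw [pow_succ]; exact ih.mul hP

variable [FiniteDimensional (constField δ) K]

theorem monic_centralZ : (centralZ δ).Monic := by
  unfold centralZ
  split_ifs with h
  · exact (minAnnihilator_spec δ).1
  · exact (OrePoly.monic_X_add_C _).pow _

theorem monic_modulus (c : K) : (modulus δ c).Monic := by
  have h := (natDegree_centralZ δ).1
  have h1 : (OrePoly.toPoly δ (centralZ δ)).Monic := monic_centralZ
  refine Polynomial.Monic.sub_of_left (p := OrePoly.toPoly δ (centralZ δ))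
    (q := Polynomial.C (upsilon δ c)) h1 ?_
  exact Polynomial.degree_C_le.trans_lt (Polynomial.natDegree_pos_iff_degree_pos.mp h)

variable {m : ℕ} {c : Fin m → K}

/-- The polynomial `∏ (x - zᵢ)`. -/
noncomputable def nodalPoly (hc : ∀ i, ¬ IsRamified δ (c i)) : (constField δ)[X] :=
  Lagrange.nodal Finset.univ fun i => ups (hc i)

theorem centralHom_nodal (hc : ∀ i, ¬ IsRamified δ (c i)) :
    (centralHom δ (nodalPoly hc)).Monic ∧
      (centralHom δ (nodalPoly hc)).natDegree = m * Module.finrank (constField δ) K := by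
  classical
  have h (S : Finset (Fin m)) : (centralHom δ (Lagrange.nodal S fun i => ups (hc i))).Monic ∧
      (centralHom δ (Lagrange.nodal S fun i => ups (hc i))).natDegree =
        S.card * Module.finrank (constField δ) K := by
    induction S using Finset.induction_on with
    | empty =>
      rw [Lagrange.nodal_empty, _root_.map_one, Finset.card_empty, zero_mul]
      exact ⟨OrePoly.monic_one, OrePoly.natDegree_C 1⟩
    | insert i S hi ih =>
      rw [Lagrange.nodal_insert_eq_nodal hi, _root_.map_mul, ← modulus_eq (hc i),
        OrePoly.natDegree_mul (monic_modulus _).ne_zero ih.1.ne_zero, ih.2,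
        natDegree_modulus (hc i), Finset.card_insert_of_notMem hi]
      exact ⟨(monic_modulus _).mul ih.1, by ring⟩
  have h1 := h Finset.univ
  rwa [Finset.card_univ, Fintype.card_fin] at h1

theorem eval_nodalPoly (hc : ∀ i, ¬ IsRamified δ (c i)) (i : Fin m) :
    (nodalPoly hc).eval (ups (hc i)) = 0 :=
  Lagrange.eval_nodal_at_node (v := fun i => ups (hc i)) (Finset.mem_univ i)

theorem evalAt_centralHom_nodal (hc : ∀ i, ¬ IsRamified δ (c i)) (i : Fin m) :
    evalAt δ (c i) (centralHom δ (nodalPoly hc)) = 0 := by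
  rw [evalAt_centralHom (hc i), eval_nodalPoly, zero_smul]

/-- Because the z_i are distinct, each is a simple zero of the nodal polynomial; this is why all the
residues needed are at simple poles. -/
theorem exists_nodalPoly_eq_mul (hc : ∀ i, ¬ IsRamified δ (c i))
    (hυ : Function.Injective fun i => upsilon δ (c i)) (i : Fin m) :
    ∃ q : (constField δ)[X], q.eval (ups (hc i)) ≠ 0 ∧
      centralHom δ (nodalPoly hc) = centralHom δ q * modulus δ (c i) := by
  classical
  refine ⟨Lagrange.nodal (Finset.univ.erase i) fun i => ups (hc i), ?_, ?_⟩
  · rw [Lagrange.eval_nodal, Finset.prod_ne_zero_iff]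
    intro j hj
    exact sub_ne_zero.mpr fun h => Finset.ne_of_mem_erase hj (ups_injective hc hυ h).symm
  · rw [modulus_eq (hc i), ← _root_.map_mul, mul_comm, nodalPoly,
      Lagrange.nodal_eq_mul_nodal_erase (Finset.mem_univ i)]

theorem sum_finrank_ker_add_range (f : Fin m → Module.End (constField δ) K) :
    ∑ i, Module.finrank (constField δ) (LinearMap.ker (f i)) +
      ∑ i, Module.finrank (constField δ) (LinearMap.range (f i)) =
        m * Module.finrank (constField δ) K := by
  rw [← Finset.sum_add_distrib, Finset.sum_congr rfl fun i _ =>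
    (add_comm _ _).trans (LinearMap.finrank_range_add_finrank_ker (f i)), Finset.sum_const,
    Finset.card_univ, Fintype.card_fin, smul_eq_mul]

theorem codim_add (V : Fin m → Submodule (constField δ) K) :
    codim δ V + ∑ i, Module.finrank (constField δ) (V i) =
      m * Module.finrank (constField δ) K := by
  rw [codim, ← Finset.sum_add_distrib, Finset.sum_congr rfl fun i _ =>
    Submodule.finrank_quotient_add_finrank (V i), Finset.sum_const,
    Finset.card_univ, Fintype.card_fin, smul_eq_mul]

/-- Take f monic of degree v = ∑ dim V_i whose evaluations vanish on the V_i; by the root count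
their kernels are exactly the V_i. The complementary factor D of f in M = ∏ (Z - z_i) satisfies f D
= M, so its images lie in the V_i, and counting dimensions gives equality. -/
theorem exists_isGoppaDivisor (hc : ∀ i, ¬ IsRamified δ (c i))
    (hυ : Function.Injective fun i => upsilon δ (c i))
    (V : Fin m → Submodule (constField δ) K) : ∃ D, IsGoppaDivisor δ c V D := by
  set v := ∑ i, Module.finrank (constField δ) (V i) with hv
  obtain ⟨hMm, hMd⟩ := centralHom_nodal hc
  obtain ⟨f, hf, hfd, hfV⟩ : ∃ f : OrePoly δ, f.Monic ∧ f.natDegree ≤ v ∧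
      ∀ i, V i ≤ LinearMap.ker (evalAt δ (c i) f) := by
    have := (OrePoly.finrank_degreeLT (δ := δ) (v + 1)).1
    have := finite_restrictions V
    -- There are v + 1 coefficients for v linear conditions over K.
    obtain ⟨⟨f, hfd⟩, hf, hf0⟩ := (Submodule.ne_bot_iff _).mp (LinearMap.ker_ne_bot_of_finrank_lt
      (f := (restrictEval c V).domRestrict (OrePoly.degreeLT δ (v + 1))) (by
        rw [finrank_restrictions, (OrePoly.finrank_degreeLT (δ := δ) (v + 1)).2]
        exact Nat.lt_succ_self _))
    have hf0' : f ≠ 0 := fun h => hf0 (Subtype.ext h)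
    have hfV : ∀ i, V i ≤ LinearMap.ker (evalAt δ (c i) f) :=
      restrictEval_eq_zero.mp (LinearMap.mem_ker.mp hf)
    obtain ⟨a, -, hm, hd⟩ := OrePoly.smul_monic hf0'
    refine ⟨a • f, hm, ?_, fun i x hx => ?_⟩
    · rw [hd]
      exact Nat.lt_succ_iff.mp ((OrePoly.mem_degreeLT_iff hf0').mp hfd)
    · rw [LinearMap.mem_ker, evalAt_smul, LinearMap.smul_apply, hfV i hx, smul_zero]
  have hfd' : f.natDegree = v := le_antisymm hfd (sum_finrank_le_natDegree hc hυ hf.ne_zero hfV)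
  obtain ⟨D, hD⟩ := exists_eq_mul_of_vanish hc hυ hf.ne_zero hfV hfd
    (h := centralHom δ (nodalPoly hc))
    fun i => by rw [evalAt_centralHom_nodal, LinearMap.ker_zero]; exact le_top
  have hDm : D.Monic := OrePoly.Monic.of_mul_left (hD ▸ hMm) hf
  have hDd := OrePoly.natDegree_mul hDm.ne_zero hf.ne_zero
  rw [← hD, hMd, ← codim_add V, hfd', ← hv, add_left_inj] at hDd
  have hfD : f * D = centralHom δ (nodalPoly hc) := by
    refine mul_right_cancel₀ hf.ne_zero ?_
    rw [mul_assoc, ← hD, (centralHom_commute _ f).eq]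
  have hVf := eq_of_le_of_sum_finrank_le hfV
    ((sum_finrank_le_natDegree hc hυ hf.ne_zero fun i => le_rfl).trans hfd)
  refine ⟨D, hDm, hDd.symm, ?_⟩
  refine eq_of_le_of_sum_finrank_le (fun i => ?_) ?_
  · rw [hVf i]
    rintro _ ⟨x, rfl⟩
    rw [LinearMap.mem_ker, ← Module.End.mul_apply, ← _root_.map_mul, hfD,
      evalAt_centralHom_nodal, LinearMap.zero_apply]
  -- The kernels of D total at most deg D = n, so its ranks total at least m[K:F] - n = v.
  · have h1 := sum_finrank_ker_add_range fun i => evalAt δ (c i) D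
    have h2 := sum_finrank_le_natDegree hc hυ hDm.ne_zero
      (U := fun i => LinearMap.ker (evalAt δ (c i) D)) fun i => le_rfl
    have h3 := codim_add V
    omega

/-- The cofactor of the Goppa divisor in `∏ (Z(X) - zᵢ)`. -/
theorem IsGoppaDivisor.exists_cofactor (hc : ∀ i, ¬ IsRamified δ (c i))
    (hυ : Function.Injective fun i => upsilon δ (c i))
    {V : Fin m → Submodule (constField δ) K} {D : OrePoly δ} (hD : IsGoppaDivisor δ c V D) :
    ∃ D' : OrePoly δ, D * D' = centralHom δ (nodalPoly hc) ∧
      D'.natDegree + codim δ V = m * Module.finrank (constField δ) K ∧ D' ≠ 0 ∧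
      ∀ i, V i ≤ LinearMap.ker (evalAt δ (c i) D') := by
  obtain ⟨hDm, hDd, hDV⟩ := hD
  obtain ⟨hMm, hMd⟩ := centralHom_nodal hc
  have h1 := sum_finrank_ker_add_range fun i => evalAt δ (c i) D
  have h3 : ∑ i, Module.finrank (constField δ) (LinearMap.range (evalAt δ (c i) D)) =
      ∑ i, Module.finrank (constField δ) (V i) :=
    Finset.sum_congr rfl fun i _ => by rw [hDV i]
  have h2 := codim_add V
  -- The images of D have total dimension ∑ dim V_i, so its kernels total n = deg D. This is the
  -- equality case, and D divides M.
  obtain ⟨D', hD'⟩ := exists_eq_mul_of_vanish hc hυ hDm.ne_zero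
    (U := fun i => LinearMap.ker (evalAt δ (c i) D)) (fun i => le_rfl) (by omega)
    (h := centralHom δ (nodalPoly hc))
    fun i => by rw [evalAt_centralHom_nodal, LinearMap.ker_zero]; exact le_top
  have hDD' : D * D' = centralHom δ (nodalPoly hc) := by
    refine mul_right_cancel₀ hDm.ne_zero ?_
    rw [mul_assoc, ← hD', (centralHom_commute _ D).eq]
  have hD'0 : D' ≠ 0 := left_ne_zero_of_mul (hD' ▸ hMm.ne_zero)
  refine ⟨D', hDD', ?_, hD'0, fun i => ?_⟩
  · rw [← hMd, hD', OrePoly.natDegree_mul hD'0 hDm.ne_zero, hDd]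
  · rw [← hDV i]
    rintro _ ⟨x, rfl⟩
    rw [LinearMap.mem_ker, ← Module.End.mul_apply, ← _root_.map_mul, ← hD',
      evalAt_centralHom_nodal, LinearMap.zero_apply]

end Cofactor

/-! ### Commutation with X + a when θ ≠ id. -/

section Twist

variable {K : Type*} [Field K] {θ : K →+* K} {δ : SkewDerivation θ}

/-- With Y = X + a, one has Y b = θ(b) Y and Y X = (Y - θ(a)) Y, so moving Y to the right of g
changes its coefficients but does not raise its degree. -/
theorem exists_X_add_twist_mul (h : θ ≠ RingHom.id K) {k : ℕ} {g : OrePoly δ}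
    (hg : g ∈ OrePoly.degreeLT δ k) : ∃ g' ∈ OrePoly.degreeLT δ k,
      (OrePoly.X δ + OrePoly.C δ (twist δ h)) * g =
        g' * (OrePoly.X δ + OrePoly.C δ (twist δ h)) := by
  set Y := OrePoly.X δ + OrePoly.C δ (twist δ h) with hY
  set Y' := OrePoly.X δ + OrePoly.C δ (twist δ h - θ (twist δ h)) with hY'
  have hYX : Y * OrePoly.X δ = Y' * Y := by
    have h1 := X_add_twist_comm δ h (twist δ h)
    rw [← hY] at h1
    have h2 : OrePoly.X δ = Y - OrePoly.C δ (twist δ h) := by rw [hY, add_sub_cancel_right]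
    have h3 : Y' = Y - OrePoly.C δ (θ (twist δ h)) := by
      rw [hY, hY', _root_.map_sub]; abel
    rw [h2, h3, mul_sub, sub_mul, h1]
  have hYX' (i : ℕ) : Y * OrePoly.X δ ^ i = Y' ^ i * Y := by
    induction i with
    | zero => rw [pow_zero, pow_zero, mul_one, one_mul]
    | succ i ih => rw [pow_succ, ← mul_assoc, ih, mul_assoc, hYX, ← mul_assoc, ← pow_succ]
  have hg' := hg
  rw [OrePoly.mem_degreeLT] at hg'
  have hsum : g = ∑ i ∈ Finset.range k, OrePoly.mono δ i (g.coeff i) := by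
    refine OrePoly.ext_coeff fun n => ?_
    rw [OrePoly.coeff_sum]
    simp only [OrePoly.coeff_mono]
    rw [Finset.sum_ite_eq' (Finset.range k) n]
    split_ifs with hn
    · rfl
    · exact hg' n (by simpa using hn)
  refine ⟨∑ i ∈ Finset.range k, θ (g.coeff i) • Y' ^ i,
    Submodule.sum_mem _ fun i hi => Submodule.smul_mem _ _ ?_, ?_⟩
  · rw [OrePoly.mem_degreeLT_iff (pow_ne_zero _ (OrePoly.X_add_C_ne_zero _)),
      OrePoly.natDegree_pow (OrePoly.X_add_C_ne_zero _), OrePoly.natDegree_X_add_C, mul_one]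
    exact Finset.mem_range.mp hi
  · conv_lhs => rw [hsum]
    rw [Finset.mul_sum, Finset.sum_mul]
    refine Finset.sum_congr rfl fun i _ => ?_
    rw [OrePoly.mono_eq, ← mul_assoc, X_add_twist_comm, mul_assoc, hYX', ← OrePoly.C_mul,
      mul_assoc]

theorem exists_X_add_twist_pow_mul (h : θ ≠ RingHom.id K) {k : ℕ} (j : ℕ) {g : OrePoly δ}
    (hg : g ∈ OrePoly.degreeLT δ k) : ∃ g' ∈ OrePoly.degreeLT δ k,
      (OrePoly.X δ + OrePoly.C δ (twist δ h)) ^ j * g =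
        g' * (OrePoly.X δ + OrePoly.C δ (twist δ h)) ^ j := by
  induction j with
  | zero => exact ⟨g, hg, by rw [pow_zero, one_mul, mul_one]⟩
  | succ j ih =>
    obtain ⟨g1, hg1, h1⟩ := ih
    obtain ⟨g2, hg2, h2⟩ := exists_X_add_twist_mul h hg1
    exact ⟨g2, hg2, by rw [pow_succ', mul_assoc, h1, ← mul_assoc, h2, mul_assoc]⟩

/-- Here ev_c(X + a) = (a + c)θ, and a + c = 0 would make δ + cθ the scalar -a. -/
theorem evalAt_X_add_twist_injective (h : θ ≠ RingHom.id K) {c : K} (hc : ¬ IsRamified δ c) :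
    Function.Injective (evalAt δ c (OrePoly.X δ + OrePoly.C δ (twist δ h))) := by
  have h1 (x : K) : evalAt δ c (OrePoly.X δ + OrePoly.C δ (twist δ h)) x =
      (twist δ h + c) * θ x := by
    rw [_root_.map_add, LinearMap.add_apply, evalAt_X, evalAt_C, pseudoLinear_apply,
      twist_spec δ h]
    ring
  rw [injective_iff_map_eq_zero]
  intro x hx
  rw [h1] at hx
  refine (map_eq_zero θ).mp ((mul_eq_zero.mp hx).resolve_left fun h0 =>
    hc ⟨-twist δ h, fun y => ?_⟩)
  rw [twist_spec δ h y]
  linear_combination (θ y) * h0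

theorem toFrac_ne_zero {f : OrePoly δ} (hf : f ≠ 0) : toFrac δ f ≠ 0 := by
  have h : IsUnit (toFrac δ f) :=
    OreLocalization.numerator_isUnit ⟨f, mem_nonZeroDivisors_of_ne_zero hf⟩
  exact h.ne_zero

variable [FiniteDimensional (constField δ) K]

/-- The scalar ev_c(Z) is a power of the injective map ev_c(X + a). -/
theorem ups_ne_zero (h : θ ≠ RingHom.id K) {c : K} (hc : ¬ IsRamified δ c) : ups hc ≠ 0 := by
  intro h0
  have h1 := evalAt_centralHom hc Polynomial.X
  rw [centralHom_X, Polynomial.eval_X, h0, zero_smul, centralZ, dif_neg h, _root_.map_pow] at h1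
  have h2 := (evalAt_X_add_twist_injective h hc).iterate (orderOf θ)
  rw [← Module.End.coe_pow, h1] at h2
  exact one_ne_zero (h2 (a₁ := (1 : K)) (a₂ := 0) rfl)

end Twist

/-! ### Residues of gP, and the parameters of the code. -/

section Goppa

variable {K : Type*} [Field K] {θ : K →+* K} {δ : SkewDerivation θ}

theorem toFrac_commute {Z : OrePoly δ} (hZ : ∀ P, Commute Z P) (P : OrePoly δ) :
    Commute (toFrac δ Z) (toFrac δ P) := (hZ P).map (toFrac δ)

/-- This provides the K-linear parametrization of the words by g, in the form that the Singleton
argument requires. -/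
theorem exists_quotient_evalAt {m : ℕ} {c : Fin m → K}
    (V : Fin m → Submodule (constField δ) K) (B : OrePoly δ)
    (hV : ∀ i, V i ≤ LinearMap.ker (evalAt δ (c i) B)) (μ : Fin m → constField δ) (k : ℕ) :
    ∃ Γ : OrePoly.degreeLT δ k →ₗ[K] (∀ i, (K ⧸ V i) →ₗ[constField δ] K),
      ∀ g i, Γ g i ∘ₗ (V i).mkQ = (μ i)⁻¹ • evalAt δ (c i) (g.1 * B) := by
  have hVg (g : OrePoly δ) (i : Fin m) :
      V i ≤ LinearMap.ker ((μ i)⁻¹ • evalAt δ (c i) (g * B)) := fun x hx => by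
    rw [LinearMap.mem_ker, LinearMap.smul_apply, _root_.map_mul, Module.End.mul_apply, hV i hx,
      _root_.map_zero, smul_zero]
  let Γ : OrePoly.degreeLT δ k →ₗ[K] (∀ i, (K ⧸ V i) →ₗ[constField δ] K) :=
    { toFun := fun g i => (V i).liftQ _ (hVg g.1 i)
      map_add' := fun g g' => funext fun i => Submodule.linearMap_qext _ <| by
        ext x
        change ((μ i)⁻¹ • evalAt δ (c i) ((g.1 + g'.1) * B)) x =
          ((μ i)⁻¹ • evalAt δ (c i) (g.1 * B)) x + ((μ i)⁻¹ • evalAt δ (c i) (g'.1 * B)) x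
        rw [add_mul, _root_.map_add, smul_add, LinearMap.add_apply]
      map_smul' := fun a g => funext fun i => Submodule.linearMap_qext _ <| by
        ext x
        change ((μ i)⁻¹ • evalAt δ (c i) ((a • g.1) * B)) x =
          a • ((μ i)⁻¹ • evalAt δ (c i) (g.1 * B)) x
        rw [OrePoly.smul_mul', evalAt_smul, LinearMap.smul_apply, LinearMap.smul_apply,
          LinearMap.smul_apply, smul_comm] }
  exact ⟨Γ, fun g i => (V i).liftQ_mkQ _ _⟩

variable [FiniteDimensional (constField δ) K] {m : ℕ} {c : Fin m → K}

theorem mem_goppaCode {V : Fin m → Submodule (constField δ) K} {k : ℕ}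
    {TS : ∀ i, TaylorExpansion δ (c i)} {φ : ∀ i, (K ⧸ V i) →ₗ[constField δ] K} :
    φ ∈ goppaCode k V TS ↔ ∃ g ∈ OrePoly.degreeLT δ k, ∀ i,
      φ i ∘ₗ (V i).mkQ = goppaGamma TS (toFrac δ g * goppaFactor δ k c V) i := Iff.rfl

theorem goppaDivisor_spec (hc : ∀ i, ¬ IsRamified δ (c i))
    (hυ : Function.Injective fun i => upsilon δ (c i))
    (V : Fin m → Submodule (constField δ) K) : IsGoppaDivisor δ c V (goppaDivisor δ c V) :=
  Classical.epsilon_spec (exists_isGoppaDivisor hc hυ V)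

/-- Up to nonzero constants, the words of the linearized Goppa code are the evaluations of the
Ore polynomials `g B`, for a suitable `B` whose evaluations vanish on the `Vᵢ`. -/
theorem exists_goppaGamma_eq (hc : ∀ i, ¬ IsRamified δ (c i))
    (hυ : Function.Injective fun i => upsilon δ (c i))
    (V : Fin m → Submodule (constField δ) K) {k : ℕ} (hkn : k < codim δ V)
    (TS : ∀ i, TaylorExpansion δ (c i)) :
    ∃ (B : OrePoly δ) (μ : Fin m → constField δ), (∀ i, μ i ≠ 0) ∧
      (∀ i, V i ≤ LinearMap.ker (evalAt δ (c i) B)) ∧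
      (∀ g i, μ i • goppaGamma TS (toFrac δ g * goppaFactor δ k c V) i =
        evalAt δ (c i) (g * B)) ∧
      ∀ g ∈ OrePoly.degreeLT δ k, g ≠ 0 →
        ∑ i, Module.finrank (constField δ) (LinearMap.ker (evalAt δ (c i) (g * B))) +
          codim δ V + 1 ≤ k + m * Module.finrank (constField δ) K := by
  have hD := goppaDivisor_spec hc hυ V
  set D := goppaDivisor δ c V with hDdef
  obtain ⟨D', hDD', hdeg, hD'0, hV⟩ := hD.exists_cofactor hc hυ
  have hD0 := toFrac_ne_zero hD.1.ne_zero
  choose q hq hqM using exists_nodalPoly_eq_mul hc hυ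
  have hinv : (toFrac δ D)⁻¹ * toFrac δ (centralHom δ (nodalPoly hc)) = toFrac δ D' := by
    rw [← hDD', _root_.map_mul, inv_mul_cancel_left₀ hD0]
  have hbound (g : OrePoly δ) (hg : g ∈ OrePoly.degreeLT δ k) (hg0 : g ≠ 0) :
      ∑ i, Module.finrank (constField δ) (LinearMap.ker (evalAt δ (c i) (g * D'))) +
          codim δ V + 1 ≤ k + m * Module.finrank (constField δ) K := by
    have h1 := sum_finrank_le_natDegree hc hυ (mul_ne_zero hg0 hD'0)
      (U := fun i => LinearMap.ker (evalAt δ (c i) (g * D'))) fun i => le_rfl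
    rw [OrePoly.natDegree_mul hg0 hD'0] at h1
    have h2 := (OrePoly.mem_degreeLT_iff hg0).mp hg
    omega
  by_cases hθ : θ = RingHom.id K
  -- Here gP M = g D', and M = q_i(Z) N_i with q_i(z_i) ≠ 0, so the residue formula applies
  -- directly.
  · refine ⟨D', fun i => (q i).eval (ups (hc i)), hq, hV, fun g i => ?_, hbound⟩
    refine (TS i).evalRes_sres (hc i) (hq i) ?_
    rw [← hqM, goppaFactor, dif_pos hθ, mul_assoc, hinv, _root_.map_mul]
  · set Y := OrePoly.X δ + OrePoly.C δ (twist δ hθ) with hY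
    set e := codim δ V - k with he
    set s := orderOf θ with hs
    have hs0 : 0 < s := (orderOf_pos_and_le δ).1
    have hZ : centralZ δ = Y ^ s := by rw [centralZ, dif_neg hθ]
    have hz (i : Fin m) : ups (hc i) ≠ 0 := ups_ne_zero hθ (hc i)
    -- The factor Z ^ (m + 1) clears the power of Z in P. It is not a pole at z_i because z_i ≠ 0,
    -- and it contributes z_i ^ (m + 1) to the constant.
    refine ⟨Y ^ e * D', fun i => (q i * X ^ (m + 1)).eval (ups (hc i)), fun i => ?_,
      fun i x hx => ?_,
      fun g i => ?_, fun g hg hg0 => ?_⟩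
    · change eval _ (q i * X ^ (m + 1)) ≠ 0
      rw [eval_mul, eval_pow, eval_X]
      exact mul_ne_zero (hq i) (pow_ne_zero _ (hz i))
    · rw [LinearMap.mem_ker, _root_.map_mul, Module.End.mul_apply, hV i hx, _root_.map_zero]
    · refine (TS i).evalRes_sres (hc i) ?_ ?_
      · rw [eval_mul, eval_pow, eval_X]
        exact mul_ne_zero (hq i) (pow_ne_zero _ (hz i))
      have hexp1 : (-(m : ℤ) - 1) = -((m + 1 : ℕ) : ℤ) := by push_cast; ring
      have hexp2 : ((codim δ V : ℤ) - k) = ((e : ℕ) : ℤ) := by rw [he]; omega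
      have hM : centralHom δ (q i * X ^ (m + 1)) * modulus δ (c i) =
          centralHom δ (nodalPoly hc) * centralZ δ ^ (m + 1) := by
        rw [hqM i, _root_.map_mul, _root_.map_pow, centralHom_X, mul_assoc, mul_assoc,
          ((centralZ_commute (modulus δ (c i))).pow_left (m + 1)).eq]
      have hZ0 : toFrac δ (centralZ δ) ^ (m + 1) ≠ 0 :=
        pow_ne_zero _ (toFrac_ne_zero monic_centralZ.ne_zero)
      have hZc (P : OrePoly δ) :
          Commute (toFrac δ (centralZ δ) ^ (m + 1)) (toFrac δ P) :=
        (toFrac_commute centralZ_commute P).pow_left _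
      rw [hM, goppaFactor, dif_neg hθ, ← hY, hexp1, hexp2, zpow_neg, zpow_natCast, zpow_natCast,
        _root_.map_mul (toFrac δ) (centralHom δ _), _root_.map_pow, ← _root_.map_pow (toFrac δ) Y,
        mul_assoc, mul_assoc, mul_assoc, ← mul_assoc (toFrac δ D)⁻¹, hinv,
        ← mul_assoc (toFrac δ (Y ^ e)), ← _root_.map_mul, ← (hZc _).eq,
        inv_mul_cancel_left₀ hZ0, ← _root_.map_mul]
    -- The degree of g Y^e D' is too large for the root count. With j + e = s e, one gets Y^j g Y^e
    -- D' = g' Y^{se} D' = g' D' Z^e with deg g' < k. At c_i the factor Z^e acts as z_i^e ≠ 0, so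
    -- the kernel of g Y^e D' lies in that of g' D', to which the bound applies.
    · obtain ⟨j, hj⟩ : ∃ j, j + e = s * e :=
        ⟨s * e - e, Nat.sub_add_cancel (Nat.le_mul_of_pos_left e hs0)⟩
      obtain ⟨g', hg', hgg'⟩ := exists_X_add_twist_pow_mul hθ j hg
      rw [← hY] at hgg'
      have hY0 : Y ≠ 0 := OrePoly.X_add_C_ne_zero _
      have hg'0 : g' ≠ 0 := left_ne_zero_of_mul (hgg' ▸ mul_ne_zero (pow_ne_zero j hY0) hg0)
      refine le_trans ?_ (hbound g' hg' hg'0)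
      refine Nat.add_le_add_right (Nat.add_le_add_right
        (Finset.sum_le_sum fun i _ => Submodule.finrank_mono fun x hx => ?_) _) _
      have h1 : Y ^ j * (g * (Y ^ e * D')) = g' * D' * centralZ δ ^ e := by
        rw [← mul_assoc, hgg', mul_assoc, ← mul_assoc (Y ^ j), ← pow_add, hj, pow_mul, ← hZ,
          mul_assoc, ((centralZ_commute D').pow_left e).eq]
      have h2 := congrArg (fun P => evalAt δ (c i) P x) h1
      rw [LinearMap.mem_ker] at hx
      rw [← centralHom_X, ← _root_.map_pow] at h2
      simp only [_root_.map_mul _ _ (centralHom δ _), _root_.map_mul _ (Y ^ j),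
        Module.End.mul_apply (evalAt δ (c i) (Y ^ j)), evalAt_centralHom (hc i)] at h2
      rw [hx, _root_.map_zero, mul_smul_comm, mul_one, LinearMap.smul_apply] at h2
      refine (smul_eq_zero.mp h2.symm).resolve_left ?_
      rw [eval_pow, eval_X]
      exact pow_ne_zero _ (hz i)

/-- The dimension and the minimum distance of the linearized Goppa codes. -/
theorem goppaCode_parameters (hc : ∀ i, ¬ IsRamified δ (c i))
    (hυ : Function.Injective fun i => upsilon δ (c i))
    (V : Fin m → Submodule (constField δ) K) {k : ℕ} (hk : 0 < k) (hkn : k < codim δ V)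
    (TS : ∀ i, TaylorExpansion δ (c i)) :
    Module.finrank K (goppaCode k V TS) = k ∧
      IsMinDistance (goppaCode k V TS) (codim δ V - k + 1) := by
  obtain ⟨B, μ, hμ, hV, hγ, hker⟩ := exists_goppaGamma_eq hc hυ V hkn TS
  have hγ' (g : OrePoly δ) (i : Fin m) : goppaGamma TS (toFrac δ g * goppaFactor δ k c V) i =
      (μ i)⁻¹ • evalAt δ (c i) (g * B) := by
    rw [← hγ, smul_smul, inv_mul_cancel₀ (hμ i), one_smul]
  obtain ⟨Γ, hΓ'⟩ := exists_quotient_evalAt V B hV μ k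
  have hΓ (g : OrePoly.degreeLT δ k) (i : Fin m) :
      Γ g i ∘ₗ (V i).mkQ = goppaGamma TS (toFrac δ g.1 * goppaFactor δ k c V) i :=
    (hΓ' g i).trans (hγ' g.1 i).symm
  have hmem (φ : ∀ i, (K ⧸ V i) →ₗ[constField δ] K) :
      φ ∈ goppaCode k V TS ↔ ∃ g, Γ g = φ := by
    rw [mem_goppaCode]
    constructor
    · rintro ⟨g, hg, h⟩
      refine ⟨⟨g, hg⟩, funext fun i => Submodule.linearMap_qext _ ?_⟩
      rw [hΓ, h]
    · rintro ⟨g, rfl⟩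
      exact ⟨g.1, g.2, fun i => hΓ g i⟩
  have hweight (g : OrePoly.degreeLT δ k) (hg : g ≠ 0) :
      codim δ V - k + 1 ≤ sumRankWeight (Γ g) := by
    have h1 := hker g.1 g.2 fun h => hg (Subtype.ext h)
    have h2 := sum_finrank_ker_add_range fun i => evalAt δ (c i) (g.1 * B)
    have h3 : sumRankWeight (Γ g) =
        ∑ i, Module.finrank (constField δ) (LinearMap.range (evalAt δ (c i) (g.1 * B))) := by
      refine Finset.sum_congr rfl fun i _ => ?_
      -- Neither the quotient map K → K / V_i nor a nonzero scalar changes the image.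
      rw [← LinearMap.range_comp_of_range_eq_top (Γ g i) (V i).range_mkQ, hΓ, hγ',
        LinearMap.range_smul _ _ (inv_ne_zero (hμ i))]
    omega
  have hinj : Function.Injective Γ := by
    rw [injective_iff_map_eq_zero]
    intro g hg
    by_contra hne
    have h1 := hweight g hne
    have h2 : sumRankWeight (Γ g) = 0 := by
      rw [hg]
      refine Finset.sum_eq_zero fun i _ => ?_
      rw [Pi.zero_apply, LinearMap.range_zero, finrank_bot]
    omega
  have hrange : goppaCode k V TS = LinearMap.range Γ := by
    ext φ
    exact hmem φ
  obtain ⟨hfin, hrk⟩ := OrePoly.finrank_degreeLT (δ := δ) k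
  refine ⟨by rw [hrange, LinearMap.finrank_range_of_inj hinj, hrk], ?_, ?_⟩
  -- The Singleton argument yields a word of weight at most n - k + 1, so the lower bound is
  -- attained.
  · obtain ⟨g, hg0, hg⟩ := exists_sumRankWeight_le Γ (hrk.symm ▸ hk) (hrk.symm ▸ hkn.le)
    have h1 := hweight g hg0
    rw [hrk] at hg
    change _ ≤ codim δ V + 1 at hg
    exact ⟨Γ g, (hmem _).mpr ⟨g, rfl⟩, fun h => hg0 (hinj (h.trans (_root_.map_zero Γ).symm)),
      by omega⟩
  · rintro w ⟨φ, hφ, hφ0, rfl⟩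
    obtain ⟨g, rfl⟩ := (hmem φ).mp hφ
    exact hweight g fun h => hφ0 (by rw [h, _root_.map_zero])

end Goppa

end OreCode

theorem mainTheorem3 {K : Type*} [Field K] (θ : K →+* K) (δ : OreCode.SkewDerivation θ)
    [FiniteDimensional (OreCode.constField δ) K]
    (hnontriv : ¬ (θ = RingHom.id K ∧ ∀ x, δ x = 0))
    (m : ℕ) (c : Fin m → K) (hc : ∀ i, ¬ OreCode.IsRamified δ (c i))
    (V : Fin m → Submodule (OreCode.constField δ) K)
    (k : ℕ) (hk : 0 < k) (hkn : k < ∑ i, Module.finrank (OreCode.constField δ) (K ⧸ V i))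
    (hυ : Function.Injective fun i => OreCode.upsilon δ (c i)) :
    (∀ i, Nonempty (OreCode.TaylorExpansion δ (c i))) ∧
    ∀ TS : ∀ i, OreCode.TaylorExpansion δ (c i),
      OreCode.codeLength (OreCode.goppaCode k V TS) =
        ∑ i, Module.finrank (OreCode.constField δ) (K ⧸ V i) ∧
      Module.finrank K (OreCode.goppaCode k V TS) = k ∧
      OreCode.IsMinDistance (OreCode.goppaCode k V TS)
        ((∑ i, Module.finrank (OreCode.constField δ) (K ⧸ V i)) - k + 1) ∧
      OreCode.IsMSRD (OreCode.goppaCode k V TS) := by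
  refine ⟨fun i => OreCode.nonempty_taylorExpansion (hc i), fun TS => ?_⟩
  obtain ⟨h1, h2⟩ := OreCode.goppaCode_parameters hc hυ V hk hkn TS
  refine ⟨rfl, h1, h2, _, h2, ?_⟩
  rw [h1]
  change k + (OreCode.codim δ V - k + 1) = OreCode.codim δ V + 1
  have h3 : k < OreCode.codim δ V := hkn
  omega
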